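/- **Setting.** Let $X,Z$ be topological spaces. All covers are finite indexed families. A *map of covers* $\{U_\alpha\}_{\alpha\in A}\to\{V_\beta\}_{\beta\in B}$ of the same space is a map $\xi:A\to B$ with $U_\alpha\subseteq V_{\xi(\alpha)}$ for all $\alpha$. A *tower* of resolution $r\in\mathbb R$ is a collection of objects $\{\mathcal W_\varepsilon\}_{\varepsilon\ge r}$ with maps $w_{\varepsilon,\varepsilon'}:\mathcal W_\varepsilon\to\mathcal W_{\varepsilon'}$ for $r\le\varepsilon\le\varepsilon'$ such that $w_{\varepsilon,\varepsilon}=\mathrm{id}$ and $w_{\varepsilon',\varepsilon''}\circ w_{\varepsilon,\varepsilon'}=w_{\varepsilon,\varepsilon''}$. A *tower of covers* of $Z$ is a tower of finite open covers of $Z$ by path connected sets, with maps of covers; a *tower of simplicial complexes* is a tower of finite simplicial complexes with simplicial maps. A continuous map $f:X\to Z$ is *well-behaved* if $f^{-1}(U)$ has finitely many path components for every path connected open $U\subseteq Z$. The pullback $f^*(\mathcal U)$ of a cover $\mathcal U$ of $Z$ is the cover of $X$ by the path components of the sets $f^{-1}(U_\alpha)$, and a map of covers $\xi$ induces the map sending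 a path component of $f^{-1}(U_\alpha)$ to the path component of $f^{-1}(V_{\xi(\alpha)})$ containing it. The *multiscale mapper* of a tower of covers $\mathfrak U$ of $Z$ is the tower of simplicial complexes $\mathrm{MM}(\mathfrak U,f)=N(f^*(\mathfrak U))$, where $N$ is the nerve. Two towers of covers $\mathfrak U,\mathfrak V$ of the same resolution $r$ are *$\eta$-interleaved* ($\eta\ge0$) if there are maps of covers $\mathcal U_\varepsilon\to\mathcal V_{\varepsilon+\eta}$ and $\mathcal V_\varepsilon\to\mathcal U_{\varepsilon+\eta}$ for all $\varepsilon\ge r$. Simplicial maps $g,h:K\to L$ are *contiguous* if $g(\sigma)\cup h(\sigma)\in L$ for all $\sigma\in K$. Two towers of simplicial complexes $(\mathcal S_\varepsilon,s)$, $(\mathcal T_\varepsilon,t)$ of the same resolution $r$ are *$\eta$-interleaved* if there are simplicial maps $\varphi_\varepsilon:\mathcal S_\varepsilon\to\mathcal T_{\varepsilon+\eta}$ and $\psi_\varepsilon:\mathcal T_\varepsilon\to\mathcal S_{\varepsilon+\eta}$ for all $\varepsilon\ge r$ such that, for all $\varepsilon'\ge\varepsilon\ge r$, the following pairs are contiguous: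 $\psi_{\varepsilon+\eta}\circ\varphi_\varepsilon$ and $s_{\varepsilon,\varepsilon+2\eta}$; $\varphi_{\varepsilon+\eta}\circ\psi_\varepsilon$ and $t_{\varepsilon,\varepsilon+2\eta}$; $\varphi_{\varepsilon'}\circ s_{\varepsilon,\varepsilon'}$ and $t_{\varepsilon+\eta,\varepsilon'+\eta}\circ\varphi_\varepsilon$; $s_{\varepsilon+\eta,\varepsilon'+\eta}\circ\psi_\varepsilon$ and $\psi_{\varepsilon'}\circ t_{\varepsilon,\varepsilon'}$. Fix a field $\mathbb K$. For a tower of simplicial complexes $\mathfrak S$, $\mathrm D_k\mathfrak S$ is the persistence diagram of the persistence module $\varepsilon\mapsto H_k(\mathcal S_\varepsilon;\mathbb K)$, extended by $0$ to $\varepsilon<r$: the multiset of points (birth, death) $\in\mathbb R\times(\mathbb R\cup\{\infty\})$ with birth $<$ death whose multiplicities are determined by the ranks of the maps of the module. The bottleneck distance of two diagrams is the infimum of the $\delta\ge0$ for which there is a partial matching of their points such that matched points are at $\ell^\infty$-distance at most $\delta$ and unmatched points are at $\ell^\infty$-distance at most $\delta$ from the diagonal. **Statement.** Let $\eta\ge0$,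 let $f:X\to Z$ be continuous and well-behaved, and let $\mathfrak U$, $\mathfrak V$ be two $\eta$-interleaved towers of covers of $Z$ of the same resolution $r>0$. Then $\mathrm{MM}(\mathfrak U,f)$ and $\mathrm{MM}(\mathfrak V,f)$ are $\eta$-interleaved. In particular, for every $k\in\mathbb N$, the bottleneck distance between $\mathrm D_k\mathrm{MM}(\mathfrak U,f)$ and $\mathrm D_k\mathrm{MM}(\mathfrak V,f)$ is at most $\eta$. -/

import Mathlib

open CategoryTheory
open scoped NNReal ENNReal

/-! ### Covers -/

/-- A finite cover of a space `X`: a finite indexed family of subsets whose union is `X`. -/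
structure Cover.{w, u} (X : Type u) where
  /-- the index set -/
  ι : Type w
  finite : Finite ι
  /-- the members of the cover -/
  set : ι → Set X
  iUnion_set : ⋃ i, set i = Set.univ

/-- A finite open cover, all of whose members are path connected. -/
structure OpenCover.{w, u} (Z : Type u) [TopologicalSpace Z] extends Cover.{w, u} Z where
  isOpen : ∀ i, IsOpen (set i)
  isPathConnected : ∀ i, IsPathConnected (set i)

/-- A map of covers `𝒰 → 𝒱`: a map `φ` of index sets with `U i ⊆ V (φ i)` for all `i`. -/
@[ext]
structure CoverMap.{w, w', u} {X : Type u} (U : Cover.{w, u} X) (V : Cover.{w', u} X) where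
  toFun : U.ι → V.ι
  subset : ∀ i, U.set i ⊆ V.set (toFun i)

namespace CoverMap

/-- The identity map of covers. -/
@[simps]
def id {X : Type*} (U : Cover X) : CoverMap U U where
  toFun i := i
  subset _ := subset_rfl

/-- Composition of maps of covers. -/
@[simps]
def comp {X : Type*} {U V W : Cover X} (φ : CoverMap U V) (ψ : CoverMap V W) :
    CoverMap U W where
  toFun i := ψ.toFun (φ.toFun i)
  subset i := (φ.subset i).trans (ψ.subset _)

end CoverMap

instance Cover.category.{w, u} (X : Type u) : Category.{w} (Cover.{w, u} X) where
  Hom U V := CoverMap U V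
  id U := CoverMap.id U
  comp φ ψ := φ.comp ψ

instance OpenCover.category.{w, u} (Z : Type u) [TopologicalSpace Z] :
    Category.{w} (OpenCover.{w, u} Z) where
  Hom U V := CoverMap U.toCover V.toCover
  id U := CoverMap.id U.toCover
  comp φ ψ := φ.comp ψ

/-- `f : X → Z` is well-behaved if the preimage of every path connected open set has finitely many
path components. -/
def WellBehaved {X Z : Type*} [TopologicalSpace X] [TopologicalSpace Z] (f : X → Z) : Prop :=
  ∀ U : Set Z, IsOpen U → IsPathConnected U → Finite (ZerothHomotopy (f ⁻¹' U))

/-- The subset of `X` underlying a path component of a subspace `A` of `X`. -/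
def pathComponentSet {X : Type*} [TopologicalSpace X] {A : Set X} (c : ZerothHomotopy A) : Set X :=
  Subtype.val '' (ZerothHomotopy.mk ⁻¹' {c})

/-- The map on path components induced by an inclusion of subspaces. -/
def pathComponentMap {X : Type*} [TopologicalSpace X] {A B : Set X} (h : A ⊆ B) :
    ZerothHomotopy A → ZerothHomotopy B :=
  ZerothHomotopy.lift (fun x => ZerothHomotopy.mk (Set.inclusion h x))
    fun _ _ γ => ZerothHomotopy.sound (γ.map (continuous_inclusion h))

/-- The pullback cover `f*(𝒰)`: its members are the path components of the sets `f⁻¹(U i)`. -/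
def OpenCover.pullback.{w, v, u} {X : Type u} {Z : Type v} [TopologicalSpace X]
    [TopologicalSpace Z] (f : C(X, Z)) (hf : WellBehaved f) (U : OpenCover.{w, v} Z) :
    Cover.{max w u, u} X where
  ι := Σ i : U.ι, ZerothHomotopy (f ⁻¹' U.set i)
  finite := by
    have := U.finite
    have := fun i => hf (U.set i) (U.isOpen i) (U.isPathConnected i)
    infer_instance
  set p := pathComponentSet p.2
  iUnion_set := by
    refine Set.eq_univ_of_forall fun x => ?_
    have hx : f x ∈ ⋃ i, U.set i := U.iUnion_set ▸ Set.mem_univ _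
    obtain ⟨i, hi⟩ := Set.mem_iUnion.1 hx
    exact Set.mem_iUnion.2 ⟨⟨i, ZerothHomotopy.mk ⟨x, hi⟩⟩, ⟨x, hi⟩, rfl, rfl⟩

/-- The pullback as a functor: a map of covers `φ` sends the path component `c` of `f⁻¹(U i)` to
the path component of `f⁻¹(V (φ i))` that contains it. -/
def pullbackFunctor.{w, v, u} {X : Type u} {Z : Type v} [TopologicalSpace X]
    [TopologicalSpace Z] (f : C(X, Z)) (hf : WellBehaved f) :
    OpenCover.{w, v} Z ⥤ Cover.{max w u, u} X where
  obj U := U.pullback f hf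
  map {U V} φ :=
    { toFun := fun p => ⟨φ.toFun p.1, pathComponentMap (Set.preimage_mono (φ.subset p.1)) p.2⟩
      subset := by
        rintro ⟨i, c⟩ _ ⟨x, hx, rfl⟩
        exact ⟨Set.inclusion (Set.preimage_mono (φ.subset i)) x,
          congrArg (pathComponentMap (Set.preimage_mono (φ.subset i))) hx, rfl⟩ }
  map_id U := by
    refine CoverMap.ext (funext ?_)
    rintro ⟨i, c⟩
    induction c with
    | mk x => rfl
  map_comp {U V W} φ ψ := by
    refine CoverMap.ext (funext ?_)
    rintro ⟨i, c⟩
    induction c with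
    | mk x => rfl

/-! ### Simplicial complexes -/

/-- A finite abstract simplicial complex over a finite vertex set. -/
structure FinComplex.{w} where
  /-- the vertex set -/
  V : Type w
  finite : Finite V
  /-- the simplices -/
  complex : PreAbstractSimplicialComplex V

/-- A simplicial map: a map of vertex sets that sends simplices to simplices. -/
@[ext]
structure SimplicialMap.{w, w'} (K : FinComplex.{w}) (L : FinComplex.{w'}) where
  toFun : K.V → L.V
  image_mem : open scoped Classical in ∀ σ ∈ K.complex.faces, σ.image toFun ∈ L.complex.faces

namespace SimplicialMap

/-- The identity simplicial map. -/
@[simps]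
def id (K : FinComplex) : SimplicialMap K K where
  toFun v := v
  image_mem σ hσ := by simpa using hσ

/-- Composition of simplicial maps. -/
@[simps]
def comp {K L M : FinComplex} (f : SimplicialMap K L) (g : SimplicialMap L M) :
    SimplicialMap K M where
  toFun v := g.toFun (f.toFun v)
  image_mem σ hσ := by
    classical
    have h := g.image_mem _ (f.image_mem σ hσ)
    rw [Finset.image_image] at h
    exact h

/-- Two simplicial maps `f, g : K → L` are contiguous if `f(σ) ∪ g(σ)` is a simplex of `L` for
every simplex `σ` of `K`. -/
def Contiguous {K L : FinComplex} (f g : SimplicialMap K L) : Prop :=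
  open scoped Classical in
  ∀ σ ∈ K.complex.faces, σ.image f.toFun ∪ σ.image g.toFun ∈ L.complex.faces

end SimplicialMap

instance FinComplex.category.{w} : Category.{w} FinComplex.{w} where
  Hom K L := SimplicialMap K L
  id K := SimplicialMap.id K
  comp f g := f.comp g

/-- The nerve of a cover: the vertices are the indices, and a non-empty set of indices is a
simplex if the corresponding members of the cover have a common point. -/
def Cover.nerve.{w, u} {X : Type u} (U : Cover.{w, u} X) : FinComplex.{w} where
  V := U.ι
  finite := U.finite
  complex :=
    { faces := {σ | σ.Nonempty ∧ (⋂ i ∈ σ, U.set i).Nonempty}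
      isRelLowerSet_faces := fun _ h =>
        ⟨h.1, fun _ hts ht => ⟨ht, h.2.mono (Set.biInter_subset_biInter_left hts)⟩⟩ }

/-- The nerve as a functor: a map of covers induces a simplicial map of nerves. -/
def nerveFunctor.{w, u} (X : Type u) : Cover.{w, u} X ⥤ FinComplex.{w} where
  obj U := U.nerve
  map {U V} φ :=
    { toFun := φ.toFun
      image_mem := by
        classical
        rintro σ ⟨hσ, x, hx⟩
        refine ⟨hσ.image _, x, ?_⟩
        simp only [Set.mem_iInter] at hx ⊢
        intro j hj
        obtain ⟨i, hi, rfl⟩ := Finset.mem_image.1 hj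
        exact φ.subset i (hx i hi) }

/-! ### Towers and interleavings -/

/-- A tower with resolution `r` of objects of `C`: objects `W ε` for the reals `ε ≥ r`, and maps
`W ε → W ε'` for `ε ≤ ε'`, compatible with identities and composition. -/
abbrev Tower.{v, u} (r : ℝ) (C : Type u) [Category.{v} C] := Set.Ici r ⥤ C

/-- The scale `ε + η`. -/
def shift {r : ℝ} (η : ℝ≥0) (ε : Set.Ici r) : Set.Ici r :=
  ⟨ε + η, le_add_of_le_of_nonneg ε.2 η.2⟩

lemma le_shift {r : ℝ} (η : ℝ≥0) (ε : Set.Ici r) : ε ≤ shift η ε :=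
  Subtype.coe_le_coe.1 (le_add_of_nonneg_right η.2)

lemma shift_mono {r : ℝ} (η : ℝ≥0) {ε ε' : Set.Ici r} (h : ε ≤ ε') : shift η ε ≤ shift η ε' :=
  Subtype.coe_le_coe.1 (add_le_add_left (Subtype.coe_le_coe.2 h) (η : ℝ))

/-- Two towers of covers are `η`-interleaved if there are maps of covers `𝒰_ε → 𝒱_{ε+η}` and
`𝒱_ε → 𝒰_{ε+η}` for all `ε ≥ r`. -/
def CoverInterleaved.{w, w', v} {Z : Type v} [TopologicalSpace Z] {r : ℝ} (η : ℝ≥0)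
    (U : Tower r (OpenCover.{w, v} Z)) (V : Tower r (OpenCover.{w', v} Z)) : Prop :=
  (∀ ε, Nonempty (CoverMap (U.obj ε).toCover (V.obj (shift η ε)).toCover)) ∧
    (∀ ε, Nonempty (CoverMap (V.obj ε).toCover (U.obj (shift η ε)).toCover))

/-- Two towers of simplicial complexes are `η`-interleaved if there are simplicial maps
`φ_ε : S_ε → T_{ε+η}` and `ψ_ε : T_ε → S_{ε+η}` for all `ε ≥ r`, such that the two triangles and
the two parallelograms formed with the maps of the towers commute up to contiguity. -/
def SimplicialInterleaved.{w, w'} {r : ℝ} (η : ℝ≥0)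
    (S : Tower r FinComplex.{w}) (T : Tower r FinComplex.{w'}) : Prop :=
  ∃ (φ : ∀ ε, SimplicialMap (S.obj ε) (T.obj (shift η ε)))
    (ψ : ∀ ε, SimplicialMap (T.obj ε) (S.obj (shift η ε))),
    (∀ ε, ((φ ε).comp (ψ (shift η ε))).Contiguous
      (S.map (homOfLE ((le_shift η ε).trans (le_shift η (shift η ε)))))) ∧
    (∀ ε, ((ψ ε).comp (φ (shift η ε))).Contiguous
      (T.map (homOfLE ((le_shift η ε).trans (le_shift η (shift η ε)))))) ∧
    (∀ (ε ε' : Set.Ici r) (h : ε ≤ ε'),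
      (SimplicialMap.comp (S.map (homOfLE h)) (φ ε')).Contiguous
        ((φ ε).comp (T.map (homOfLE (shift_mono η h))))) ∧
    (∀ (ε ε' : Set.Ici r) (h : ε ≤ ε'),
      ((ψ ε).comp (S.map (homOfLE (shift_mono η h)))).Contiguous
        (SimplicialMap.comp (T.map (homOfLE h)) (ψ ε')))

/-- The multiscale mapper `MM(𝔘, f) = N(f*(𝔘))`. -/
def multiscaleMapper.{w, v, u} {X : Type u} {Z : Type v} [TopologicalSpace X] [TopologicalSpace Z]
    {r : ℝ} (U : Tower r (OpenCover.{w, v} Z)) (f : C(X, Z)) (hf : WellBehaved f) :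
    Tower r FinComplex.{max w u} :=
  U ⋙ pullbackFunctor f hf ⋙ nerveFunctor X

/-! ### Simplicial homology -/

/-- The simplicial set of ordered simplices of a complex `K`: its `n`-simplices are the tuples
`(v₀, …, vₙ)` of vertices, repetitions allowed, such that `{v₀, …, vₙ}` is a simplex of `K`. Its
chain complex is the ordered chain complex of `K`, which computes the simplicial homology
of `K`. -/
def orderedSimplices.{w} : FinComplex.{w} ⥤ SSet.{w} where
  obj K :=
    { obj := fun n => {s : Fin (n.unop.len + 1) → K.V //
        open scoped Classical in Finset.univ.image s ∈ K.complex.faces}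
      map := fun θ => ↾fun s => ⟨s.1 ∘ θ.unop.toOrderHom, by
        classical
        refine (K.complex.isRelLowerSet_faces s.2).2 ?_ (Finset.univ_nonempty.image _)
        intro v hv
        simp only [Finset.mem_image, Finset.mem_univ, true_and] at hv ⊢
        obtain ⟨i, rfl⟩ := hv
        exact ⟨_, rfl⟩⟩ }
  map {K L} f :=
    { app := fun n => ↾fun s => ⟨f.toFun ∘ s.1, by
        classical
        have h := f.image_mem _ s.2
        rw [Finset.image_image] at h
        exact h⟩ }

/-- The `k`-th simplicial homology functor with coefficients in the field `𝕜`. -/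
noncomputable def simplicialHomology.{w, t} (𝕜 : Type t) [Field 𝕜] (k : ℕ) :
    FinComplex.{w} ⥤ ModuleCat.{max w t} 𝕜 :=
  orderedSimplices.{w} ⋙ SSet.homologyFunctor (ModuleCat.of 𝕜 (ULift.{w} 𝕜)) k

/-! ### Persistence diagrams -/

/-- The rank of the map `M s → M t` of a tower of vector spaces with resolution `r`, where the
tower is extended by zero to all real scales `s < r`. -/
noncomputable def persistentRank.{w, t} {𝕜 : Type t} [Field 𝕜] {r : ℝ}
    (M : Tower r (ModuleCat.{w} 𝕜)) (s t : ℝ) : ℕ :=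
  open scoped Classical in
  if h : r ≤ s ∧ s ≤ t then
    Module.finrank 𝕜 (LinearMap.range
      (M.map (homOfLE (show (⟨s, h.1⟩ : Set.Ici r) ≤ ⟨t, h.1.trans h.2⟩ from h.2))).hom)
  else 0

/-- The same rank for `t ∈ ℝ ∪ {∞}`, with the convention that it is `0` for `t = ∞`. -/
noncomputable def persistentRankE.{w, t} {𝕜 : Type t} [Field 𝕜] {r : ℝ}
    (M : Tower r (ModuleCat.{w} 𝕜)) (s : ℝ) (t : EReal) : ℕ :=
  open scoped Classical in if t = ⊤ then 0 else persistentRank M s t.toReal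

/-- The number of classes that are born in the scales from `a` to `b` and die in the scales
from `c` to `d`, where `a < b < c < d ≤ ∞`. -/
noncomputable def boxMultiplicity.{w, t} {𝕜 : Type t} [Field 𝕜] {r : ℝ}
    (M : Tower r (ModuleCat.{w} 𝕜)) (a b c : ℝ) (d : EReal) : ℤ :=
  (persistentRank M b c - persistentRank M a c : ℤ) -
    (persistentRankE M b d - persistentRankE M a d : ℤ)

/-- The points `(birth, death)` with `birth < death`, `birth ∈ ℝ` and `death ∈ ℝ ∪ {∞}`. -/
abbrev DiagramPoint := {p : ℝ × EReal // (p.1 : EReal) < p.2}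

/-- A persistence diagram: a multiset of points above the diagonal, given by multiplicities. -/
abbrev PersistenceDiagram := DiagramPoint → ℕ

/-- The persistence diagram of a tower of finite-dimensional vector spaces. The multiplicity of
`(b, d)` is the least multiplicity of a box that has `(b, d)` in its interior; the neighbourhoods of
a point at infinity are the boxes that reach up to death `∞`. -/
noncomputable def persistenceDiagram.{w, t} {𝕜 : Type t} [Field 𝕜] {r : ℝ}
    (M : Tower r (ModuleCat.{w} 𝕜)) : PersistenceDiagram := fun p =>
  sInf {n : ℕ | ∃ (a b c : ℝ) (d : EReal),
    a < p.1.1 ∧ p.1.1 < b ∧ b < c ∧ (c : EReal) < p.1.2 ∧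
    (p.1.2 < d ∨ p.1.2 = ⊤ ∧ d = ⊤) ∧ (n : ℤ) = boxMultiplicity M a b c d}

/-- The `k`-th persistence diagram `D_k 𝔖` of a tower of simplicial complexes, with coefficients
in the field `𝕜`. -/
noncomputable def simplicialPersistenceDiagram.{w, t} (𝕜 : Type t) [Field 𝕜] (k : ℕ) {r : ℝ}
    (S : Tower r FinComplex.{w}) : PersistenceDiagram :=
  persistenceDiagram (S ⋙ simplicialHomology 𝕜 k)

namespace PersistenceDiagram

/-- The points of a diagram, repeated according to multiplicity. -/
abbrev Point (D : PersistenceDiagram) := Σ p : DiagramPoint, Fin (D p)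

/-- `p` and `q` are at `ℓ^∞` distance at most `δ`, where a point at infinity is at finite distance
only from points at infinity. -/
def Close (δ : ℝ≥0) (p q : DiagramPoint) : Prop :=
  |p.1.1 - q.1.1| ≤ δ ∧ p.1.2 ≤ q.1.2 + ((δ : ℝ) : EReal) ∧ q.1.2 ≤ p.1.2 + ((δ : ℝ) : EReal)

/-- `p` is at `ℓ^∞` distance at most `δ` from the diagonal. -/
def NearDiagonal (δ : ℝ≥0) (p : DiagramPoint) : Prop :=
  p.1.2 ≤ ((p.1.1 + 2 * δ : ℝ) : EReal)

/-- A partial matching of the points of `D` and `D'` that moves no point by more than `δ`, where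
the unmatched points are matched to the diagonal. -/
def HasMatching (D D' : PersistenceDiagram) (δ : ℝ≥0) : Prop :=
  ∃ P : Point D ≃. Point D',
    (∀ x y, y ∈ P x → Close δ x.1 y.1) ∧
    (∀ x, P x = none → NearDiagonal δ x.1) ∧
    (∀ y, P.symm y = none → NearDiagonal δ y.1)

/-- The bottleneck distance of two persistence diagrams. -/
noncomputable def bottleneckDist (D D' : PersistenceDiagram) : ℝ≥0∞ :=
  ⨅ (δ : ℝ≥0) (_ : HasMatching D D' δ), (δ : ℝ≥0∞)

end PersistenceDiagram

universe w w' v u t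

/-! ### Rank functions and their diagrams -/

/-! A map of covers pulls back along `f` and induces a simplicial map of nerves. Any two maps of
covers with the same source and target induce contiguous maps, since a point common to the members
indexed by a simplex also lies in the members indexed by its image under either map
(`CoverMap.contiguous`). Hence arbitrarily chosen maps from the interleaving of covers satisfy all
four contiguity conditions.

Contiguous maps agree on homology, so the homology towers `M`, `N` are interleaved strictly, and
they are finite-dimensional at each scale. What remains is algebraic stability. It is proved with
ranks alone, without interval decompositions, by matching through the image of the interleaving
morphism from `M` to the `η`-shift of `N`. The surjection of `M` onto the image preserves births,
and the inclusion of the image into the shifted `N` preserves deaths. Points with a common birth are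
labelled by decreasing death, points with a common death by increasing birth, and equal labels are
matched.

Since the structure maps over a length `2η` factor through the image, deaths drop by at most `2η` in
the first step and births drop by at most `2η` in the second. After undoing the shift, both
coordinates move by at most `η` (`RankInterleaving.death_bounds`, `RankInterleaving.birth_bounds`),
and only points within `η` of the diagonal can stay unmatched. The rank inequalities needed
(`RankInterleaving`) come from `finrank_range_comp_add_le`. The two complexes may live in different
universes, so they are first lifted to a common one, which does not change ranks. -/

/-- A function with the properties of the rank function `(s, t) ↦ rank (M s → M t)` of a
persistence module that vanishes at all sufficiently small scales and at the scale `∞`. -/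
structure IsRankFunction (ρ : ℝ → EReal → ℕ) : Prop where
  mono : ∀ {s s' : ℝ} {t : EReal}, s ≤ s' → (s' : EReal) ≤ t → ρ s t ≤ ρ s' t
  anti : ∀ {s : ℝ} {t t' : EReal}, (s : EReal) ≤ t → t ≤ t' → ρ s t' ≤ ρ s t
  box : ∀ {a b : ℝ} {c d : EReal}, a ≤ b → (b : EReal) ≤ c → c ≤ d →
    ρ b d + ρ a c ≤ ρ b c + ρ a d
  top : ∀ s, ρ s ⊤ = 0
  bdd : ∃ r, ∀ s < r, ∀ t, ρ s t = 0

/-- `d'` lies beyond `d`, where `∞` lies beyond itself. -/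
def Beyond (d d' : EReal) : Prop := d < d' ∨ d = ⊤ ∧ d' = ⊤

lemma Beyond.le {d d' : EReal} (h : Beyond d d') : d ≤ d' := by
  rcases h with h | ⟨rfl, rfl⟩
  exacts [h.le, le_rfl]

lemma beyond_top (d : EReal) : Beyond d ⊤ := by
  by_cases h : d = ⊤
  · exact Or.inr ⟨h, rfl⟩
  · exact Or.inl (lt_top_iff_ne_top.2 h)

lemma beyond_min {d x y : EReal} (hx : Beyond d x) (hy : Beyond d y) : Beyond d (min x y) := by
  rcases min_choice x y with h | h <;> rwa [h]

/-- The diagram determined by a rank function. -/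
noncomputable def rankDiagram (ρ : ℝ → EReal → ℕ) : PersistenceDiagram := fun p =>
  sInf {n : ℕ | ∃ (a b c : ℝ) (d : EReal),
    a < p.1.1 ∧ p.1.1 < b ∧ b < c ∧ (c : EReal) < p.1.2 ∧ Beyond p.1.2 d ∧
    (n : ℤ) = (ρ b c - ρ a c : ℤ) - (ρ b d - ρ a d : ℤ)}

lemma exists_minimizer {α : Type*} (f : α → ℕ) {S : Set α} (hS : S.Nonempty) :
    ∃ a ∈ S, ∀ x ∈ S, f a ≤ f x := by
  obtain ⟨_, ⟨a, ha, rfl⟩, h⟩ := WellFounded.has_min Nat.lt_wfRel.wf (f '' S) (hS.image f)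
  exact ⟨a, ha, fun x hx => not_lt.1 (h _ ⟨x, hx, rfl⟩)⟩

lemma exists_maximizer {α : Type*} (f : α → ℕ) {S : Set α} (hS : S.Nonempty) {B : ℕ}
    (hB : ∀ x ∈ S, f x ≤ B) : ∃ a ∈ S, ∀ x ∈ S, f x ≤ f a := by
  obtain ⟨a, ha, h⟩ := exists_minimizer (fun x => B - f x) hS
  refine ⟨a, ha, fun x hx => ?_⟩
  have := h x hx
  have := hB x hx
  have := hB a ha
  grind

/-- A box around `(b, d)` so small that the rank function is constant near each of its corners. -/
structure IsStableBox (ρ : ℝ → EReal → ℕ) (b : ℝ) (d : EReal) (a₀ b₀ c₀ : ℝ) (d₀ : EReal) :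
    Prop where
  left : a₀ < b
  right : b < b₀
  lt : b₀ < c₀
  lower : (c₀ : EReal) < d
  upper : Beyond d d₀
  eq_left : ∀ s, a₀ ≤ s → s < b → ∀ x : EReal, c₀ ≤ x → ρ s x = ρ a₀ x
  eq_right : ∀ s, b < s → s ≤ b₀ → ∀ x : EReal, c₀ ≤ x → ρ s x = ρ b₀ x
  eq_lower : ∀ x : EReal, c₀ ≤ x → x < d → ρ a₀ x = ρ a₀ c₀ ∧ ρ b₀ x = ρ b₀ c₀
  eq_upper : ∀ x : EReal, x ≤ d₀ → Beyond d x → ρ a₀ x = ρ a₀ d₀ ∧ ρ b₀ x = ρ b₀ d₀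

namespace IsRankFunction

variable {ρ : ℝ → EReal → ℕ} (hρ : IsRankFunction ρ)

include hρ

/-- Ranks are natural numbers, so the one-sided limits at `b` and `d` are attained. Constancy in the
birth variable is arranged at the single death `c`; the box inequality then carries it to every
later death. -/
lemma exists_isStableBox {b : ℝ} {d : EReal} (hbd : (b : EReal) < d) :
    ∃ a₀ b₀ c₀ d₀, IsStableBox ρ b d a₀ b₀ c₀ d₀ := by
  obtain ⟨c, hbc, hcd⟩ := EReal.lt_iff_exists_real_btwn.1 hbd
  have hbc' : b < c := EReal.coe_lt_coe_iff.1 hbc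
  obtain ⟨a₀, ha₀, ha⟩ := exists_maximizer (fun s => ρ s c) (S := Set.Iio b) (B := ρ b c)
    ⟨b - 1, by simp⟩ fun s hs => hρ.mono (le_of_lt hs) hbc.le
  obtain ⟨b₀, hb₀, hb⟩ := exists_minimizer (fun s => ρ s c) (S := Set.Ioo b c)
    (Set.nonempty_Ioo.2 hbc')
  -- Both summands are antitone in `x`, so a minimal sum makes each of them constant from `c₀` up to
  -- `d`. The sum maximised for `d₀` plays the same role beyond `d`.
  obtain ⟨c₀, ⟨hc₀, hc₀d⟩, hc⟩ := exists_minimizer (fun x : ℝ => ρ a₀ x + ρ b₀ x)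
    (S := {x : ℝ | c ≤ x ∧ (x : EReal) < d}) ⟨c, le_rfl, hcd⟩
  simp only [Set.mem_Iio, Set.mem_Ioo, Set.mem_ofPred_eq] at ha₀ ha hb₀ hb hc
  have hab : a₀ ≤ b₀ := by linarith
  have hb₀c : (b₀ : EReal) ≤ c₀ := EReal.coe_le_coe_iff.2 (by linarith)
  have ha₀c : (a₀ : EReal) ≤ c₀ := EReal.coe_le_coe_iff.2 (by linarith)
  obtain ⟨d₀, hd₀, hd⟩ := exists_maximizer (fun x => ρ a₀ x + ρ b₀ x) (S := {x | Beyond d x})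
    (B := ρ a₀ c₀ + ρ b₀ c₀) ⟨⊤, beyond_top d⟩ fun x hx =>
      add_le_add (hρ.anti ha₀c (hc₀d.le.trans hx.le)) (hρ.anti hb₀c (hc₀d.le.trans hx.le))
  simp only [Set.mem_ofPred_eq] at hd₀ hd
  refine ⟨a₀, b₀, c₀, d₀, ha₀, hb₀.1, hb₀.2.trans_le hc₀, hc₀d, hd₀, ?_, ?_, ?_, ?_⟩
  · intro s hs hsb x hx
    have hcx : (c : EReal) ≤ x := (EReal.coe_le_coe_iff.2 hc₀).trans hx
    have hsc : (s : EReal) ≤ c := EReal.coe_le_coe_iff.2 (by linarith)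
    have h1 := hρ.mono hs (hsc.trans hcx)
    have h2 := hρ.box hs hsc hcx
    have h3 := ha s hsb
    omega
  · intro s hs hsb x hx
    have hcx : (c : EReal) ≤ x := (EReal.coe_le_coe_iff.2 hc₀).trans hx
    have hsc : (b₀ : EReal) ≤ c := EReal.coe_le_coe_iff.2 (by linarith)
    have h1 := hρ.mono hsb (hsc.trans hcx)
    have h2 := hρ.box hsb hsc hcx
    have h3 := hb s ⟨hs, by linarith⟩
    omega
  · intro x hx hxd
    lift x to ℝ using ⟨ne_top_of_lt hxd, ne_bot_of_le_ne_bot (EReal.coe_ne_bot _) hx⟩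
    have h1 := hρ.anti ha₀c hx
    have h2 := hρ.anti hb₀c hx
    have h3 := hc x ⟨hc₀.trans (EReal.coe_le_coe_iff.1 hx), hxd⟩
    omega
  · intro x hx hxd
    have h1 := hρ.anti (ha₀c.trans (hc₀d.le.trans hxd.le)) hx
    have h2 := hρ.anti (hb₀c.trans (hc₀d.le.trans hxd.le)) hx
    have h3 := hd x hxd
    omega

/-- Counts decrease when a box shrinks. Intersecting any competing box with the stable one gives a
box with the same count as the stable box, so the stable box attains the minimum. -/
lemma rankDiagram_eq {p : DiagramPoint} {a₀ b₀ c₀ : ℝ} {d₀ : EReal}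
    (h : IsStableBox ρ p.1.1 p.1.2 a₀ b₀ c₀ d₀) :
    (rankDiagram ρ p : ℤ) = (ρ b₀ c₀ - ρ a₀ c₀ : ℤ) - (ρ b₀ d₀ - ρ a₀ d₀ : ℤ) := by
  have hab : a₀ ≤ b₀ := (h.left.trans h.right).le
  have hbc : (b₀ : EReal) ≤ c₀ := EReal.coe_le_coe_iff.2 h.lt.le
  have hcd : (c₀ : EReal) ≤ d₀ := h.lower.le.trans h.upper.le
  have hbox := hρ.box hab hbc hcd
  obtain ⟨n, hn⟩ : ∃ n : ℕ, (n : ℤ) = (ρ b₀ c₀ - ρ a₀ c₀ : ℤ) - (ρ b₀ d₀ - ρ a₀ d₀ : ℤ) :=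
    ⟨ρ b₀ c₀ + ρ a₀ d₀ - (ρ b₀ d₀ + ρ a₀ c₀), by omega⟩
  rw [← hn, Nat.cast_inj]
  refine IsLeast.csInf_eq ⟨⟨a₀, b₀, c₀, d₀, h.left, h.right, h.lt, h.lower, h.upper, hn⟩, ?_⟩
  rintro m ⟨a, b, c, d, ha, hb, hbc', hc, hd, hm⟩
  have e1 := h.eq_left (max a a₀) (le_max_right _ _) (max_lt ha h.left)
  have e2 := h.eq_right (min b b₀) (lt_min hb h.right) (min_le_right _ _)
  have hc₁ : ((max c c₀ : ℝ) : EReal) < p.1.2 := by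
    rcases max_choice c c₀ with h' | h' <;> rw [h']
    exacts [hc, h.lower]
  have hd₁ := beyond_min hd h.upper
  have hcc : (c₀ : EReal) ≤ (max c c₀ : ℝ) := EReal.coe_le_coe_iff.2 (le_max_right _ _)
  have e3 := h.eq_lower (max c c₀ : ℝ) hcc hc₁
  have e4 := h.eq_upper (min d d₀) (min_le_right _ _) hd₁
  have f1 := e1 (max c c₀ : ℝ) hcc
  have f2 := e2 (max c c₀ : ℝ) hcc
  have f3 := e1 (min d d₀) (h.lower.le.trans hd₁.le)
  have f4 := e2 (min d d₀) (h.lower.le.trans hd₁.le)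
  have hac : a ≤ max a a₀ := le_max_left _ _
  have hbb : min b b₀ ≤ b := min_le_left _ _
  have hcd' : ((max c c₀ : ℝ) : EReal) ≤ min d d₀ := hc₁.le.trans hd₁.le
  have hba : max a a₀ ≤ min b b₀ :=
    (max_lt ha h.left).le.trans (lt_min hb h.right).le
  have hbc₁ : (b : EReal) ≤ c := EReal.coe_le_coe_iff.2 hbc'.le
  have hcc₁ : (c : EReal) ≤ (max c c₀ : ℝ) := EReal.coe_le_coe_iff.2 (le_max_left _ _)
  have hbb' : ((min b b₀ : ℝ) : EReal) ≤ b := EReal.coe_le_coe_iff.2 hbb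
  have haa' : ((max a a₀ : ℝ) : EReal) ≤ (min b b₀ : ℝ) := EReal.coe_le_coe_iff.2 hba
  -- The box is trimmed one side at a time: lower death, upper death, lower birth, upper birth. Each
  -- strip cut off has non-negative count.
  have g1 := hρ.box (hac.trans (hba.trans hbb)) hbc₁ hcc₁
  have g2 := hρ.box (hac.trans (hba.trans hbb)) (hbc₁.trans (hcc₁.trans hcd'))
    (min_le_left d d₀)
  have g3 := hρ.box hac (haa'.trans (hbb'.trans (hbc₁.trans hcc₁))) hcd'
  have g4 := hρ.box hbb (hbc₁.trans hcc₁) hcd'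
  omega

end IsRankFunction

/-! ### Labels for points with a common birth or a common death -/

/-- At least `i + 1` classes that are born at `b` are alive before `x`. -/
def BornAlive (ρ : ℝ → EReal → ℕ) (b : ℝ) (i : ℕ) (x : EReal) : Prop :=
  ∀ a b' : ℝ, a < b → b < b' → (b' : EReal) < x → ρ a x + i < ρ b' x

/-- At least `j + 1` classes that die at `d` are born up to `y`. -/
def DyingBorn (ρ : ℝ → EReal → ℕ) (d : EReal) (j : ℕ) (y : ℝ) : Prop :=
  ∀ (c : ℝ) (d' : EReal), y < c → (c : EReal) < d → Beyond d d' → ρ y d' + j < ρ y c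

/-- The positions of the classes `(b, d)` among the classes born at `b`, ordered by decreasing
death. -/
def birthKeys (ρ : ℝ → EReal → ℕ) (b : ℝ) (d : EReal) : Set ℕ :=
  {i | (∀ c : ℝ, b < c → (c : EReal) < d → BornAlive ρ b i c) ∧
    ∀ d', Beyond d d' → ¬ BornAlive ρ b i d'}

/-- The positions of the classes `(b, d)` among the classes dying at `d`, ordered by increasing
birth. -/
def deathKeys (ρ : ℝ → EReal → ℕ) (b : ℝ) (d : EReal) : Set ℕ :=
  {j | (∀ y : ℝ, b < y → (y : EReal) < d → DyingBorn ρ d j y) ∧ ∀ y < b, ¬ DyingBorn ρ d j y}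

/-- If the deaths differed, at a scale strictly between them the `i`-th class born at `b` would be
both alive and dead. -/
lemma birthKeys_unique {ρ : ℝ → EReal → ℕ} {b : ℝ} {d₁ d₂ : EReal} {i : ℕ} (h₁ : (b : EReal) < d₁)
    (h₂ : (b : EReal) < d₂) (hi₁ : i ∈ birthKeys ρ b d₁) (hi₂ : i ∈ birthKeys ρ b d₂) :
    d₁ = d₂ := by
  wlog h : d₁ < d₂ generalizing d₁ d₂
  · rcases eq_or_lt_of_le (not_lt.1 h) with h' | h'
    exacts [h'.symm, (this h₂ h₁ hi₂ hi₁ h').symm]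
  obtain ⟨c, hc₁, hc₂⟩ := EReal.lt_iff_exists_real_btwn.1 h
  exact absurd (hi₂.1 c (EReal.coe_lt_coe_iff.1 (h₁.trans hc₁)) hc₂) (hi₁.2 c (Or.inl hc₁))

lemma deathKeys_unique {ρ : ℝ → EReal → ℕ} {b₁ b₂ : ℝ} {d : EReal} {j : ℕ} (h₁ : (b₁ : EReal) < d)
    (h₂ : (b₂ : EReal) < d) (hj₁ : j ∈ deathKeys ρ b₁ d) (hj₂ : j ∈ deathKeys ρ b₂ d) :
    b₁ = b₂ := by
  wlog h : b₁ < b₂ generalizing b₁ b₂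
  · rcases eq_or_lt_of_le (not_lt.1 h) with h' | h'
    exacts [h'.symm, (this h₂ h₁ hj₂ hj₁ h').symm]
  obtain ⟨y, hy₁, hy₂⟩ := exists_between h
  exact absurd (hj₁.1 y hy₁ ((EReal.coe_lt_coe_iff.2 hy₂).trans h₂)) (hj₂.2 y hy₂)

namespace IsRankFunction

variable {ρ : ℝ → EReal → ℕ} (hρ : IsRankFunction ρ)

include hρ

lemma bornAlive_anti {b : ℝ} {i : ℕ} {x x' : EReal} (hx : x ≤ x')
    (h : BornAlive ρ b i x') : BornAlive ρ b i x := by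
  intro a b' ha hb hbx
  have h1 := h a b' ha hb (hbx.trans_le hx)
  have h2 := hρ.box (ha.trans hb).le hbx.le hx
  omega

lemma dyingBorn_mono {d : EReal} {j : ℕ} {y y' : ℝ} (hy : y ≤ y')
    (h : DyingBorn ρ d j y) : DyingBorn ρ d j y' := by
  intro c d' hc hcd hd
  have h1 := h c d' (hy.trans_lt hc) hcd hd
  have h2 := hρ.box hy (EReal.coe_le_coe_iff.2 hc.le) (hcd.le.trans hd.le)
  omega

/-- On a stable box being alive is a single rank inequality. The labels of `(b, d)` are those of
classes born at `b` and alive just before `d`, minus those still alive beyond `d`. -/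
lemma birthKeys_eq {b : ℝ} {d : EReal} {a₀ b₀ c₀ : ℝ} {d₀ : EReal}
    (h : IsStableBox ρ b d a₀ b₀ c₀ d₀) :
    birthKeys ρ b d = Set.Ico (ρ b₀ d₀ - ρ a₀ d₀) (ρ b₀ c₀ - ρ a₀ c₀) := by
  have key : ∀ (i : ℕ) (x : EReal), c₀ ≤ x → (BornAlive ρ b i x ↔ ρ a₀ x + i < ρ b₀ x) := by
    intro i x hx
    have hbx : (b₀ : EReal) < x := (EReal.coe_lt_coe_iff.2 h.lt).trans_le hx
    refine ⟨fun H => H a₀ b₀ h.left h.right hbx, fun H a b' ha hb hb' => ?_⟩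
    have e1 := h.eq_left (max a a₀) (le_max_right _ _) (max_lt ha h.left) x hx
    have e2 := h.eq_right (min b' b₀) (lt_min hb h.right) (min_le_right _ _) x hx
    have h1 := hρ.mono (le_max_left a a₀)
      ((EReal.coe_lt_coe_iff.2 ((max_lt ha h.left).trans h.right)).le.trans hbx.le)
    have h2 := hρ.mono (min_le_left b' b₀) hb'.le
    omega
  have hcd : (c₀ : EReal) ≤ d₀ := h.lower.le.trans h.upper.le
  ext i
  simp only [birthKeys, Set.mem_ofPred_eq, Set.mem_Ico]
  constructor
  · rintro ⟨h1, h2⟩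
    have k1 := (key i c₀ le_rfl).1 (h1 c₀ (h.right.trans h.lt) h.lower)
    have k2 := mt (key i d₀ hcd).2 (h2 d₀ h.upper)
    omega
  · rintro ⟨h1, h2⟩
    refine ⟨fun c hbc hc => ?_, fun d' hd' H => ?_⟩
    · have hc' : ((max c c₀ : ℝ) : EReal) < d := by
        rcases max_choice c c₀ with h' | h' <;> rw [h']
        exacts [hc, h.lower]
      have hcc : (c₀ : EReal) ≤ (max c c₀ : ℝ) := EReal.coe_le_coe_iff.2 (le_max_right _ _)
      refine hρ.bornAlive_anti (EReal.coe_le_coe_iff.2 (le_max_left c c₀)) ((key _ _ hcc).2 ?_)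
      have := h.eq_lower _ hcc hc'
      omega
    · have hm := beyond_min hd' h.upper
      have k := (key _ _ (h.lower.le.trans hm.le)).1 (hρ.bornAlive_anti (min_le_left d' d₀) H)
      have := h.eq_upper _ (min_le_right d' d₀) hm
      omega

lemma deathKeys_eq {b : ℝ} {d : EReal} {a₀ b₀ c₀ : ℝ} {d₀ : EReal}
    (h : IsStableBox ρ b d a₀ b₀ c₀ d₀) :
    deathKeys ρ b d = Set.Ico (ρ a₀ c₀ - ρ a₀ d₀) (ρ b₀ c₀ - ρ b₀ d₀) := by
  have hab : a₀ < b₀ := h.left.trans h.right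
  have key : ∀ (j : ℕ) (y : ℝ), y < c₀ →
      (∀ x : EReal, c₀ ≤ x → x < d → ρ y x = ρ y c₀) →
      (∀ x : EReal, x ≤ d₀ → Beyond d x → ρ y x = ρ y d₀) →
      (DyingBorn ρ d j y ↔ ρ y d₀ + j < ρ y c₀) := by
    intro j y hy e1 e2
    refine ⟨fun H => H c₀ d₀ hy h.lower h.upper, fun H c d' hyc hcd hd => ?_⟩
    have hc' : ((max c c₀ : ℝ) : EReal) < d := by
      rcases max_choice c c₀ with h' | h' <;> rw [h']
      exacts [hcd, h.lower]
    have e1 := e1 _ (EReal.coe_le_coe_iff.2 (le_max_right c c₀)) hc'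
    have hm := beyond_min hd h.upper
    have e2 := e2 _ (min_le_right d' d₀) hm
    have hyc' : (y : EReal) ≤ c := EReal.coe_le_coe_iff.2 hyc.le
    have h1 := hρ.anti hyc' (EReal.coe_le_coe_iff.2 (le_max_left c c₀))
    have h2 := hρ.anti (hyc'.trans (hcd.le.trans hm.le)) (min_le_left d' d₀)
    omega
  have keya := fun j => key j a₀ (hab.trans h.lt) (fun x h1 h2 => (h.eq_lower x h1 h2).1)
    (fun x h1 h2 => (h.eq_upper x h1 h2).1)
  have keyb := fun j => key j b₀ h.lt (fun x h1 h2 => (h.eq_lower x h1 h2).2)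
    (fun x h1 h2 => (h.eq_upper x h1 h2).2)
  have hcd : (c₀ : EReal) ≤ d₀ := h.lower.le.trans h.upper.le
  ext j
  simp only [deathKeys, Set.mem_ofPred_eq, Set.mem_Ico]
  constructor
  · rintro ⟨h1, h2⟩
    have k1 := (keyb j).1 (h1 b₀ h.right ((EReal.coe_lt_coe_iff.2 h.lt).trans h.lower))
    have k2 := mt (keya j).2 (h2 a₀ h.left)
    omega
  · rintro ⟨h1, h2⟩
    refine ⟨fun y hby hy => ?_, fun y hy H => ?_⟩
    · have hyb : b < min y b₀ := lt_min hby h.right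
      refine hρ.dyingBorn_mono (min_le_left y b₀) ((key j (min y b₀)
        ((min_le_right _ _).trans_lt h.lt) ?_ ?_).2 ?_)
      · intro x hx hxd
        rw [h.eq_right _ hyb (min_le_right _ _) x hx,
          h.eq_right _ hyb (min_le_right _ _) c₀ le_rfl, (h.eq_lower x hx hxd).2]
      · intro x hx hxd
        rw [h.eq_right _ hyb (min_le_right _ _) x (h.lower.le.trans hxd.le),
          h.eq_right _ hyb (min_le_right _ _) d₀ hcd, (h.eq_upper x hx hxd).2]
      · rw [h.eq_right _ hyb (min_le_right _ _) c₀ le_rfl,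
          h.eq_right _ hyb (min_le_right _ _) d₀ hcd]
        omega
    · have hya : max y a₀ < b := max_lt hy h.left
      have k := hρ.dyingBorn_mono (le_max_left y a₀) H c₀ d₀ (hya.trans (h.right.trans h.lt))
        h.lower h.upper
      rw [h.eq_left _ (le_max_right _ _) hya c₀ le_rfl,
        h.eq_left _ (le_max_right _ _) hya d₀ hcd] at k
      omega

/-- The length of the interval of labels is the count of a stable box, which is the multiplicity of
the point. -/
lemma card_birthKeys (p : DiagramPoint) :
    Nonempty (Fin (rankDiagram ρ p) ≃ birthKeys ρ p.1.1 p.1.2) := by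
  obtain ⟨a₀, b₀, c₀, d₀, h⟩ := hρ.exists_isStableBox p.2
  have h1 := hρ.rankDiagram_eq h
  have hbc : (b₀ : EReal) ≤ c₀ := EReal.coe_le_coe_iff.2 h.lt.le
  have hcd : (c₀ : EReal) ≤ d₀ := h.lower.le.trans h.upper.le
  have h2 := hρ.mono (h.left.trans h.right).le hbc
  have h3 := hρ.mono (h.left.trans h.right).le (hbc.trans hcd)
  rw [hρ.birthKeys_eq h]
  refine ⟨(Fintype.equivFinOfCardEq ?_).symm⟩
  rw [Fintype.card_ofFinset, Nat.card_Ico]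
  omega

lemma card_deathKeys (p : DiagramPoint) :
    Nonempty (Fin (rankDiagram ρ p) ≃ deathKeys ρ p.1.1 p.1.2) := by
  obtain ⟨a₀, b₀, c₀, d₀, h⟩ := hρ.exists_isStableBox p.2
  have h1 := hρ.rankDiagram_eq h
  have hbc : (b₀ : EReal) ≤ c₀ := EReal.coe_le_coe_iff.2 h.lt.le
  have hac : (a₀ : EReal) ≤ c₀ :=
    EReal.coe_le_coe_iff.2 ((h.left.trans h.right).trans h.lt).le
  have hcd : (c₀ : EReal) ≤ d₀ := h.lower.le.trans h.upper.le
  have h2 := hρ.anti hac hcd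
  have h3 := hρ.anti hbc hcd
  rw [hρ.deathKeys_eq h]
  refine ⟨(Fintype.equivFinOfCardEq ?_).symm⟩
  rw [Fintype.card_ofFinset, Nat.card_Ico]
  omega

/-- The death is the supremum of the scales at which the `i`-th class born at `b` is alive. -/
lemma exists_mem_birthKeys {b x : ℝ} {i : ℕ} (hbx : b < x) (h : BornAlive ρ b i x) :
    ∃ d : EReal, (b : EReal) < d ∧ i ∈ birthKeys ρ b d := by
  set S : Set EReal := {x | (b : EReal) < x ∧ BornAlive ρ b i x}
  have hxS : (x : EReal) ∈ S := ⟨EReal.coe_lt_coe_iff.2 hbx, h⟩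
  refine ⟨sSup S, hxS.1.trans_le (le_sSup hxS), fun c _ hc => ?_, fun d' hd' H => ?_⟩
  · obtain ⟨z, hz, hcz⟩ := lt_sSup_iff.1 hc
    exact hρ.bornAlive_anti hcz.le hz.2
  · rcases hd' with hd' | ⟨-, rfl⟩
    · exact hd'.not_ge (le_sSup ⟨(hxS.1.trans_le (le_sSup hxS)).trans hd', H⟩)
    -- If the supremum is `∞`, the convention that ranks vanish at `∞` makes the class die there.
    · have := H (b - 1) (b + 1) (by linarith) (by linarith) (EReal.coe_lt_top _)
      simp [hρ.top] at this

/-- The birth is the infimum of the scales by which the `j`-th class dying at `d` is born. It is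
finite because ranks vanish at all small scales. -/
lemma exists_mem_deathKeys {y : ℝ} {d : EReal} {j : ℕ} (hyd : (y : EReal) < d)
    (h : DyingBorn ρ d j y) : ∃ b : ℝ, (b : EReal) < d ∧ j ∈ deathKeys ρ b d := by
  obtain ⟨r, hr⟩ := hρ.bdd
  set S : Set ℝ := {y | (y : EReal) < d ∧ DyingBorn ρ d j y}
  have hS : BddBelow S := by
    refine ⟨r, fun y hy => not_lt.1 fun hyr => ?_⟩
    obtain ⟨c, hc₁, hc₂⟩ := EReal.lt_iff_exists_real_btwn.1 hy.1
    have := hy.2 c ⊤ (EReal.coe_lt_coe_iff.1 hc₁) hc₂ (beyond_top d)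
    rw [hr y hyr, hr y hyr] at this
    omega
  have hyS : y ∈ S := ⟨hyd, h⟩
  have hd : ((sInf S : ℝ) : EReal) < d :=
    (EReal.coe_le_coe_iff.2 (csInf_le hS hyS)).trans_lt hyd
  refine ⟨sInf S, hd, fun z hz _ => ?_, fun z hz H => ?_⟩
  · obtain ⟨z', hz', hlt⟩ := (csInf_lt_iff hS ⟨y, hyS⟩).1 hz
    exact hρ.dyingBorn_mono hlt.le hz'.2
  · exact hz.not_ge (csInf_le hS ⟨(EReal.coe_lt_coe_iff.2 hz).trans hd, H⟩)

end IsRankFunction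

/-! ### Matching the points of diagrams -/

section Matching

open PersistenceDiagram

namespace IsRankFunction

variable {ρ : ℝ → EReal → ℕ}

/-- The position of a point of the diagram among the points with the same birth. -/
noncomputable def birthKey (hρ : IsRankFunction ρ) (x : Point (rankDiagram ρ)) : ℕ :=
  (hρ.card_birthKeys x.1).some x.2

/-- The position of a point of the diagram among the points with the same death. -/
noncomputable def deathKey (hρ : IsRankFunction ρ) (x : Point (rankDiagram ρ)) : ℕ :=
  (hρ.card_deathKeys x.1).some x.2

lemma birthKey_mem (hρ : IsRankFunction ρ) (x : Point (rankDiagram ρ)) :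
    hρ.birthKey x ∈ birthKeys ρ x.1.1.1 x.1.1.2 :=
  ((hρ.card_birthKeys x.1).some x.2).2

lemma deathKey_mem (hρ : IsRankFunction ρ) (x : Point (rankDiagram ρ)) :
    hρ.deathKey x ∈ deathKeys ρ x.1.1.1 x.1.1.2 :=
  ((hρ.card_deathKeys x.1).some x.2).2

lemma exists_birthKey_eq (hρ : IsRankFunction ρ) (p : DiagramPoint) {i : ℕ}
    (hi : i ∈ birthKeys ρ p.1.1 p.1.2) :
    ∃ x : Point (rankDiagram ρ), x.1 = p ∧ hρ.birthKey x = i :=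
  ⟨⟨p, (hρ.card_birthKeys p).some.symm ⟨i, hi⟩⟩, rfl, by simp [birthKey]⟩

lemma exists_deathKey_eq (hρ : IsRankFunction ρ) (p : DiagramPoint) {j : ℕ}
    (hj : j ∈ deathKeys ρ p.1.1 p.1.2) :
    ∃ x : Point (rankDiagram ρ), x.1 = p ∧ hρ.deathKey x = j :=
  ⟨⟨p, (hρ.card_deathKeys p).some.symm ⟨j, hj⟩⟩, rfl, by simp [deathKey]⟩

/-- Label intervals of different deaths are disjoint, so birth and label determine the point,
including its copy among repeated points. -/
lemma birthKey_inj (hρ : IsRankFunction ρ) {x y : Point (rankDiagram ρ)}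
    (hb : x.1.1.1 = y.1.1.1) (h : hρ.birthKey x = hρ.birthKey y) : x = y := by
  obtain ⟨⟨⟨b, d⟩, hx⟩, i⟩ := x
  obtain ⟨⟨⟨b', d'⟩, hy⟩, j⟩ := y
  obtain rfl : b = b' := hb
  have h1 := hρ.birthKey_mem ⟨⟨(b, d), hx⟩, i⟩
  rw [h] at h1
  obtain rfl : d = d' := birthKeys_unique hx hy h1 (hρ.birthKey_mem ⟨⟨(b, d'), hy⟩, j⟩)
  obtain rfl : i = j := (hρ.card_birthKeys _).some.injective (Subtype.ext h)
  rfl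

lemma deathKey_inj (hρ : IsRankFunction ρ) {x y : Point (rankDiagram ρ)}
    (hd : x.1.1.2 = y.1.1.2) (h : hρ.deathKey x = hρ.deathKey y) : x = y := by
  obtain ⟨⟨⟨b, d⟩, hx⟩, i⟩ := x
  obtain ⟨⟨⟨b', d'⟩, hy⟩, j⟩ := y
  obtain rfl : d = d' := hd
  have h1 := hρ.deathKey_mem ⟨⟨(b, d), hx⟩, i⟩
  rw [h] at h1
  obtain rfl : b = b' := deathKeys_unique hx hy h1 (hρ.deathKey_mem ⟨⟨(b', d), hy⟩, j⟩)
  obtain rfl : i = j := (hρ.card_deathKeys _).some.injective (Subtype.ext h)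
  rfl

end IsRankFunction

/-- A relation that is functional in both directions is a partial bijection. -/
lemma exists_pequiv_of_rel {α β : Type*} (R : α → β → Prop)
    (h₁ : ∀ {a b b'}, R a b → R a b' → b = b') (h₂ : ∀ {a a' b}, R a b → R a' b → a = a') :
    ∃ P : α ≃. β, (∀ a b, b ∈ P a ↔ R a b) ∧ ∀ a b, a ∈ P.symm b ↔ R a b := by
  classical
  have e1 : ∀ a b, b ∈ (if h : ∃ b, R a b then some h.choose else none) ↔ R a b := by
    intro a b
    split_ifs with h
    · rw [Option.mem_some_iff]
      exact ⟨fun e => e ▸ h.choose_spec, fun e => h₁ h.choose_spec e⟩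
    · simpa using fun e => h ⟨b, e⟩
  have e2 : ∀ a b, a ∈ (if h : ∃ a, R a b then some h.choose else none) ↔ R a b := by
    intro a b
    split_ifs with h
    · rw [Option.mem_some_iff]
      exact ⟨fun e => e ▸ h.choose_spec, fun e => h₂ h.choose_spec e⟩
    · simpa using fun e => h ⟨a, e⟩
  exact ⟨⟨fun a => if h : ∃ b, R a b then some h.choose else none,
    fun b => if h : ∃ a, R a b then some h.choose else none,
    fun a b => (e2 a b).trans (e1 a b).symm⟩, e1, e2⟩

/-! ### The matching through the image of the interleaving morphism -/

/-- Rank inequalities between the rank functions `ρ` and `ρ'` of two `η`-interleaved persistence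
modules and the rank function `τ` of the image of the interleaving morphism. -/
structure RankInterleaving (η : ℝ≥0) (ρ τ ρ' : ℝ → EReal → ℕ) : Prop where
  left : IsRankFunction ρ
  image : IsRankFunction τ
  right : IsRankFunction ρ'
  image_left : ∀ {s s' t : ℝ}, s ≤ s' → s' ≤ t → τ s' t + ρ s t ≤ ρ s' t + τ s t
  left_image : ∀ {s s' t : ℝ}, s ≤ s' → s' ≤ t →
    ρ s' (t + 2 * η : ℝ) + τ s t ≤ τ s' t + ρ s (t + 2 * η : ℝ)
  image_right : ∀ {s t : ℝ} {t' : EReal}, s ≤ t → (t : EReal) ≤ t' →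
    τ s t + ρ' (s + η) (t' + (η : ℝ)) ≤ ρ' (s + η) (t + η : ℝ) + τ s t'
  right_image : ∀ {s t : ℝ} {t' : EReal}, s + 2 * η ≤ t → (t : EReal) ≤ t' →
    ρ' (s + η) (t + η : ℝ) + τ (s + 2 * η) t' ≤
      τ (s + 2 * η) t + ρ' (s + η) (t' + (η : ℝ))

lemma beyond_add {d d' : EReal} (x : ℝ) (h : Beyond d d') : Beyond (d + x) (d' + x) := by
  rcases h with h | ⟨rfl, rfl⟩
  · exact Or.inl (EReal.add_lt_add_right_coe h x)
  · exact Or.inr ⟨EReal.top_add_coe x, EReal.top_add_coe x⟩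

lemma ereal_add_neg_add (d : EReal) (x : ℝ) : d + (-x : ℝ) + x = d := by
  rw [add_assoc, ← EReal.coe_add]; simp

lemma ereal_add_add_neg (d : EReal) (x : ℝ) : d + x + (-x : ℝ) = d := by
  rw [add_assoc, ← EReal.coe_add]; simp

namespace RankInterleaving

variable {η : ℝ≥0} {ρ τ ρ' : ℝ → EReal → ℕ} (H : RankInterleaving η ρ τ ρ')

include H

/-- This reflects surjectivity onto the image: classes of the image lift to classes with the same
birth that live at least as long. -/
lemma bornAlive_left {b x : ℝ} {i : ℕ} (h : BornAlive τ b i x) : BornAlive ρ b i x := by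
  intro a b' ha hb hbx
  have h1 := h a b' ha hb hbx
  have h2 := H.image_left (ha.trans hb).le (EReal.coe_le_coe_iff.1 hbx.le)
  omega

/-- A class that survives `2η` further has non-zero image, because the structure map over `2η`
factors through the image. -/
lemma bornAlive_image {b x : ℝ} {i : ℕ} (h : BornAlive ρ b i (x + 2 * η : ℝ)) :
    BornAlive τ b i x := by
  intro a b' ha hb hbx
  have hbx' : b' < x := EReal.coe_lt_coe_iff.1 hbx
  have h1 := h a b' ha hb (EReal.coe_lt_coe_iff.2 (by have := η.2; linarith))
  have h2 := H.left_image (ha.trans hb).le hbx'.le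
  omega

lemma dyingBorn_right {d : EReal} {y : ℝ} {j : ℕ} (h : DyingBorn τ d j y) :
    DyingBorn ρ' (d + (η : ℝ)) j (y + η) := by
  intro c d' hc hcd hd
  have hcd' : ((c - η : ℝ) : EReal) < d := by
    have := EReal.add_lt_add_right_coe hcd (-η)
    rwa [ereal_add_add_neg, ← EReal.coe_add, ← sub_eq_add_neg] at this
  have hd' := beyond_add (-η) hd
  rw [ereal_add_add_neg] at hd'
  -- `ρ'` is indexed by unshifted scales, `τ` by the scales of `M`; subtracting `η` translates
  -- between them.
  have h1 := h (c - η) (d' + (-η : ℝ)) (by linarith) hcd' hd'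
  have h2 := H.image_right (s := y) (t := c - η) (by linarith) (hcd'.le.trans hd'.le)
  rw [ereal_add_neg_add, sub_add_cancel] at h2
  omega

lemma dyingBorn_image {d : EReal} {y : ℝ} {j : ℕ}
    (h : DyingBorn ρ' (d + (η : ℝ)) j (y + η)) : DyingBorn τ d j (y + 2 * η) := by
  intro c d' hc hcd hd
  have h1 := h (c + η) (d' + (η : ℝ)) (by have := η.2; linarith)
    (by rw [EReal.coe_add]; exact EReal.add_lt_add_right_coe hcd η) (beyond_add η hd)
  have h2 := H.right_image (s := y) (t := c) hc.le (hcd.le.trans hd.le)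
  omega

lemma exists_left (z : Point (rankDiagram τ)) : ∃ x : Point (rankDiagram ρ),
    x.1.1.1 = z.1.1.1 ∧ H.left.birthKey x = H.image.birthKey z := by
  obtain ⟨x, hx₁, hx₂⟩ := EReal.lt_iff_exists_real_btwn.1 z.1.2
  have hx₁ := EReal.coe_lt_coe_iff.1 hx₁
  obtain ⟨d, hd, hi⟩ := H.left.exists_mem_birthKeys hx₁
    (H.bornAlive_left ((H.image.birthKey_mem z).1 x hx₁ hx₂))
  obtain ⟨x, hx, h⟩ := H.left.exists_birthKey_eq ⟨(z.1.1.1, d), hd⟩ hi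
  exact ⟨x, by rw [hx], h⟩

/-- A violation of either bound leaves room for a scale `c` at which the common label is alive in
one diagram and dead in the other, against the comparison of live classes. -/
lemma death_bounds {x : Point (rankDiagram ρ)} {z : Point (rankDiagram τ)}
    (hb : x.1.1.1 = z.1.1.1) (h : H.left.birthKey x = H.image.birthKey z) :
    z.1.1.2 ≤ x.1.1.2 ∧ x.1.1.2 ≤ z.1.1.2 + (2 * η : ℝ) := by
  have hx := H.left.birthKey_mem x
  have hz := H.image.birthKey_mem z
  rw [h, hb] at hx
  constructor
  · by_contra! hlt
    obtain ⟨c, hc₁, hc₂⟩ := EReal.lt_iff_exists_real_btwn.1 hlt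
    have hbc := EReal.coe_lt_coe_iff.1 (x.1.2.trans hc₁)
    exact hx.2 c (Or.inl hc₁) (H.bornAlive_left (hz.1 c (hb ▸ hbc) hc₂))
  · by_contra! hlt
    obtain ⟨c, hc₁, hc₂⟩ := EReal.lt_iff_exists_real_btwn.1 hlt
    have hc := EReal.add_lt_add_right_coe hc₁ (-(2 * η : ℝ))
    rw [ereal_add_add_neg, ← EReal.coe_add, ← sub_eq_add_neg] at hc
    have hbc := EReal.coe_lt_coe_iff.1 (z.1.2.trans hc)
    refine hz.2 _ (Or.inl hc) (H.bornAlive_image ?_)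
    rw [sub_add_cancel]
    exact hx.1 c (by have := η.2; linarith) hc₂

/-- A point of persistence more than `2η` is still alive after its birth once `2η` is subtracted
from some scale before its death, so its label survives in the image. -/
lemma exists_image_of_left (x : Point (rankDiagram ρ)) (hx : ¬ NearDiagonal η x.1) :
    ∃ z : Point (rankDiagram τ),
      x.1.1.1 = z.1.1.1 ∧ H.left.birthKey x = H.image.birthKey z := by
  obtain ⟨c, hc₁, hc₂⟩ := EReal.lt_iff_exists_real_btwn.1 (not_le.1 hx)
  have hc₁ := EReal.coe_lt_coe_iff.1 hc₁
  obtain ⟨d, hd, hi⟩ := H.image.exists_mem_birthKeys (x := c - 2 * η) (b := x.1.1.1)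
    (by linarith) (H.bornAlive_image (by
      rw [sub_add_cancel]
      exact (H.left.birthKey_mem x).1 c (by have := η.2; linarith) hc₂))
  obtain ⟨z, hz, h⟩ := H.image.exists_birthKey_eq ⟨(x.1.1.1, d), hd⟩ hi
  exact ⟨z, by rw [hz], h.symm⟩

lemma exists_right (z : Point (rankDiagram τ)) : ∃ y : Point (rankDiagram ρ'),
    y.1.1.2 = z.1.1.2 + (η : ℝ) ∧ H.right.deathKey y = H.image.deathKey z := by
  obtain ⟨x, hx₁, hx₂⟩ := EReal.lt_iff_exists_real_btwn.1 z.1.2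
  have hx₁ := EReal.coe_lt_coe_iff.1 hx₁
  have hlt : ((x + η : ℝ) : EReal) < z.1.1.2 + (η : ℝ) := by
    rw [EReal.coe_add]; exact EReal.add_lt_add_right_coe hx₂ η
  obtain ⟨b, hb, hj⟩ := H.right.exists_mem_deathKeys hlt
    (H.dyingBorn_right ((H.image.deathKey_mem z).1 x hx₁ hx₂))
  obtain ⟨y, hy, h⟩ := H.right.exists_deathKey_eq ⟨(b, z.1.1.2 + (η : ℝ)), hb⟩ hj
  exact ⟨y, by rw [hy], h⟩

/-- In shifted coordinates the birth of `z` lies between that of `y` and `2η` later, since the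
inclusion of the image can only delay births. Centring this interval gives the bound `η`. -/
lemma birth_bounds {y : Point (rankDiagram ρ')} {z : Point (rankDiagram τ)}
    (hd : y.1.1.2 = z.1.1.2 + (η : ℝ)) (h : H.right.deathKey y = H.image.deathKey z) :
    |z.1.1.1 - y.1.1.1| ≤ η := by
  have hy := H.right.deathKey_mem y
  have hz := H.image.deathKey_mem z
  rw [h, hd] at hy
  have hyd := y.1.2
  rw [hd] at hyd
  rw [abs_le]
  constructor
  · by_contra! hlt
    obtain ⟨c, hc₁, hc₂⟩ := exists_between (show z.1.1.1 < y.1.1.1 - η by linarith)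
    have hcd : (c : EReal) < z.1.1.2 := by
      have h1 := (EReal.coe_lt_coe_iff.2 (show c + η < y.1.1.1 by linarith)).trans hyd
      have := EReal.add_lt_add_right_coe h1 (-η)
      rwa [ereal_add_add_neg, ← EReal.coe_add, add_neg_cancel_right] at this
    exact hy.2 (c + η) (by linarith) (H.dyingBorn_right (hz.1 c hc₁ hcd))
  · by_contra! hlt
    obtain ⟨c, hc₁, hc₂⟩ := exists_between (show y.1.1.1 + η < z.1.1.1 by linarith)
    have hcd : (c : EReal) < z.1.1.2 := (EReal.coe_lt_coe_iff.2 hc₂).trans z.1.2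
    have hcd' : ((c - η : ℝ) : EReal) < z.1.1.2 + (η : ℝ) :=
      (EReal.coe_le_coe_iff.2 (show c - η ≤ c + η by have := η.2; linarith)).trans_lt (by
        rw [EReal.coe_add]; exact EReal.add_lt_add_right_coe hcd η)
    have h1 := hy.1 (c - η) (by linarith) hcd'
    have h2 := H.dyingBorn_image (y := c - 2 * η) (by
      rwa [show c - 2 * η + η = c - (η : ℝ) by ring])
    rw [sub_add_cancel] at h2
    exact hz.2 c hc₂ h2

lemma exists_image_of_right (y : Point (rankDiagram ρ')) (hy : ¬ NearDiagonal η y.1) :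
    ∃ z : Point (rankDiagram τ),
      y.1.1.2 = z.1.1.2 + (η : ℝ) ∧ H.right.deathKey y = H.image.deathKey z := by
  obtain ⟨c, hc₁, hc₂⟩ := EReal.lt_iff_exists_real_btwn.1 (not_le.1 hy)
  have hc₁ := EReal.coe_lt_coe_iff.1 hc₁
  have hcd : ((c - η : ℝ) : EReal) < y.1.1.2 + (-η : ℝ) := by
    rw [sub_eq_add_neg, EReal.coe_add]; exact EReal.add_lt_add_right_coe hc₂ (-η)
  have hη := η.2
  obtain ⟨b, hb, hj⟩ := H.image.exists_mem_deathKeys (y := c - η) (j := H.right.deathKey y) hcd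
    (by
      -- The choice `c - 3 * η` makes the shift by `2η` land at `c - η`, while `c - 2 * η` is still
      -- beyond the birth of `y` by the choice of `c`.
      have := H.dyingBorn_image (d := y.1.1.2 + (-η : ℝ)) (y := c - 3 * η)
        (j := H.right.deathKey y) (by
          rw [ereal_add_neg_add]
          refine (H.right.deathKey_mem y).1 _ ?_ ?_
          · linarith
          · refine lt_of_le_of_lt (EReal.coe_le_coe_iff.2 ?_) hc₂
            linarith)
      rwa [show c - 3 * η + 2 * η = c - (η : ℝ) by ring] at this)
  obtain ⟨z, hz, h⟩ := H.image.exists_deathKey_eq ⟨(b, y.1.1.2 + (-η : ℝ)), hb⟩ hj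
  exact ⟨z, by rw [hz]; exact (ereal_add_neg_add _ _).symm, h.symm⟩

/-- Diagrams of interleaved persistence modules can be matched. -/
theorem hasMatching : HasMatching (rankDiagram ρ) (rankDiagram ρ') η := by
  obtain ⟨P, hP, hP'⟩ := exists_pequiv_of_rel
    (fun (x : Point (rankDiagram ρ)) (y : Point (rankDiagram ρ')) =>
      ∃ z : Point (rankDiagram τ),
        (x.1.1.1 = z.1.1.1 ∧ H.left.birthKey x = H.image.birthKey z) ∧
        (y.1.1.2 = z.1.1.2 + (η : ℝ) ∧ H.right.deathKey y = H.image.deathKey z))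
    (by
      rintro x y y' ⟨z, ⟨h1, h2⟩, h3, h4⟩ ⟨z', ⟨h1', h2'⟩, h3', h4'⟩
      obtain rfl := H.image.birthKey_inj (h1.symm.trans h1') (h2.symm.trans h2')
      exact H.right.deathKey_inj (h3.trans h3'.symm) (h4.trans h4'.symm))
    (by
      rintro x x' y ⟨z, ⟨h1, h2⟩, h3, h4⟩ ⟨z', ⟨h1', h2'⟩, h3', h4'⟩
      have hd : z.1.1.2 = z'.1.1.2 := by
        rw [← ereal_add_add_neg z.1.1.2 η, ← h3, h3', ereal_add_add_neg]
      obtain rfl := H.image.deathKey_inj hd (h4.symm.trans h4')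
      exact H.left.birthKey_inj (h1.trans h1'.symm) (h2.trans h2'.symm))
  refine ⟨P, fun x y hxy => ?_, fun x hx => ?_, fun y hy => ?_⟩
  · obtain ⟨z, ⟨h1, h2⟩, h3, h4⟩ := (hP x y).1 hxy
    obtain ⟨h5, h6⟩ := H.death_bounds h1 h2
    refine ⟨?_, ?_, ?_⟩
    · rw [h1]
      exact H.birth_bounds h3 h4
    · rwa [h3, add_assoc, ← EReal.coe_add, ← two_mul]
    · rw [h3]
      exact add_le_add_left h5 _
  · by_contra hn
    obtain ⟨z, hz⟩ := H.exists_image_of_left x hn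
    obtain ⟨y, hy⟩ := H.exists_right z
    have := (hP x y).2 ⟨z, hz, hy⟩
    rw [hx] at this
    cases this
  · by_contra hn
    obtain ⟨z, hz⟩ := H.exists_image_of_right y hn
    obtain ⟨x, hx⟩ := H.exists_left z
    have := (hP' x y).2 ⟨z, hx, hz⟩
    rw [hy] at this
    cases this

end RankInterleaving

end Matching

/-! ### Interleaved towers of vector spaces -/

section LinearAlgebra

variable {𝕜 A B V V' : Type*} [Field 𝕜] [AddCommGroup A] [Module 𝕜 A] [AddCommGroup B]
  [Module 𝕜 B] [AddCommGroup V] [Module 𝕜 V] [AddCommGroup V'] [Module 𝕜 V']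

/-- Applying `f` to a subspace `W` loses the dimension of `W ⊓ ker f`, and this loss grows with `W`.
-/
lemma finrank_range_comp_add_le [Module.Finite 𝕜 V] (g : A →ₗ[𝕜] V) (h : B →ₗ[𝕜] V)
    (f : V →ₗ[𝕜] V') (hgh : LinearMap.range g ≤ LinearMap.range h) :
    Module.finrank 𝕜 (LinearMap.range (f ∘ₗ h)) + Module.finrank 𝕜 (LinearMap.range g) ≤
      Module.finrank 𝕜 (LinearMap.range h) + Module.finrank 𝕜 (LinearMap.range (f ∘ₗ g)) := by
  have key : ∀ W : Submodule 𝕜 V, Module.finrank 𝕜 (W.map f) +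
      Module.finrank 𝕜 (W ⊓ LinearMap.ker f : Submodule 𝕜 V) = Module.finrank 𝕜 W := by
    intro W
    have h1 := LinearMap.finrank_range_add_finrank_ker (f.domRestrict W)
    rw [LinearMap.range_domRestrict, LinearMap.ker_domRestrict] at h1
    rw [← h1, ← Submodule.map_comap_subtype, Submodule.finrank_map_subtype_eq]
  rw [LinearMap.range_comp, LinearMap.range_comp]
  have h1 := key (LinearMap.range g)
  have h2 := key (LinearMap.range h)
  have h3 := Submodule.finrank_mono (inf_le_inf_right (LinearMap.ker f) hgh)
  omega

lemma finrank_range_comp_le [Module.Finite 𝕜 V] (g : A →ₗ[𝕜] V) (f : V →ₗ[𝕜] V') :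
    Module.finrank 𝕜 (LinearMap.range (f ∘ₗ g)) ≤ Module.finrank 𝕜 (LinearMap.range g) := by
  rw [LinearMap.range_comp]
  exact Submodule.finrank_map_le f _

end LinearAlgebra

/-! ### Rank functions of towers and of the image of an interleaving -/

/-- The extension of a function of two real scales by zero at the second scale `∞`. -/
noncomputable def extendTop (ρ : ℝ → ℝ → ℕ) (s : ℝ) (t : EReal) : ℕ :=
  open scoped Classical in if t = ⊤ then 0 else ρ s t.toReal

@[simp]
lemma extendTop_coe (ρ : ℝ → ℝ → ℕ) (s t : ℝ) : extendTop ρ s t = ρ s t := by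
  simp [extendTop]

@[simp]
lemma extendTop_top (ρ : ℝ → ℝ → ℕ) (s : ℝ) : extendTop ρ s ⊤ = 0 := by
  simp [extendTop]

lemma isRankFunction_extendTop {ρ : ℝ → ℝ → ℕ}
    (mono : ∀ {s s' t : ℝ}, s ≤ s' → s' ≤ t → ρ s t ≤ ρ s' t)
    (anti : ∀ {s t t' : ℝ}, s ≤ t → t ≤ t' → ρ s t' ≤ ρ s t)
    (box : ∀ {a b c d : ℝ}, a ≤ b → b ≤ c → c ≤ d → ρ b d + ρ a c ≤ ρ b c + ρ a d)
    {r : ℝ} (bdd : ∀ s < r, ∀ t, ρ s t = 0) : IsRankFunction (extendTop ρ) where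
  mono {s s' t} h h' := by
    induction t with
    | bot => simp at h'
    | top => simp
    | coe t => simpa using mono h (EReal.coe_le_coe_iff.1 h')
  anti {s t t'} h h' := by
    induction t' with
    | bot => simp [le_bot_iff.1 h'] at h
    | top => simp
    | coe t' =>
      induction t with
      | bot => simp at h
      | top => simp at h'
      | coe t => simpa using anti (EReal.coe_le_coe_iff.1 h) (EReal.coe_le_coe_iff.1 h')
  box {a b c d} h h' h'' := by
    induction c with
    | bot => simp at h'
    | top => simp [top_le_iff.1 h'']
    | coe c =>
      have h' := EReal.coe_le_coe_iff.1 h'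
      induction d with
      | bot => simp at h''
      -- With `d = ∞` two terms vanish and the box inequality becomes monotonicity in the birth.
      | top => simpa using mono h h'
      | coe d => simpa using box h h' (EReal.coe_le_coe_iff.1 h'')
  top s := by simp
  bdd := ⟨r, fun s hs t => by simp [extendTop, bdd s hs]⟩

section Towers

universe u₃ u₀

variable {𝕜 : Type u₀} [Field 𝕜] {r : ℝ}

lemma persistentRankE_eq (M : Tower r (ModuleCat.{u₃} 𝕜)) :
    persistentRankE M = extendTop (persistentRank M) := rfl

lemma persistenceDiagram_eq (M : Tower r (ModuleCat.{u₃} 𝕜)) :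
    persistenceDiagram M = rankDiagram (persistentRankE M) := by
  funext p
  simp only [persistenceDiagram, rankDiagram, boxMultiplicity, Beyond, persistentRankE_eq,
    extendTop_coe]

lemma persistentRank_coe (M : Tower r (ModuleCat.{u₃} 𝕜)) {ε ε' : Set.Ici r} (h : ε ≤ ε') :
    persistentRank M ε ε' =
      Module.finrank 𝕜 (LinearMap.range (M.map (homOfLE h)).hom) :=
  dif_pos ⟨ε.2, h⟩

lemma persistentRank_of_lt (M : Tower r (ModuleCat.{u₃} 𝕜)) {s t : ℝ} (h : s < r) :
    persistentRank M s t = 0 :=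
  dif_neg fun h' => h'.1.not_gt h

lemma Tower.map_hom_comp (M : Tower r (ModuleCat.{u₃} 𝕜)) {ε ε' ε'' : Set.Ici r} (h : ε ≤ ε')
    (h' : ε' ≤ ε'') : (M.map (homOfLE (h.trans h'))).hom =
      (M.map (homOfLE h')).hom ∘ₗ (M.map (homOfLE h)).hom := by
  rw [← ModuleCat.hom_comp, ← M.map_comp]
  rfl

/-- Interleavings of towers of vector spaces. -/
structure ModuleInterleaving (η : ℝ≥0) (M N : Tower r (ModuleCat.{u₃} 𝕜)) where
  φ : ∀ ε, M.obj ε ⟶ N.obj (shift η ε)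
  ψ : ∀ ε, N.obj ε ⟶ M.obj (shift η ε)
  φ_ψ : ∀ ε, φ ε ≫ ψ (shift η ε) =
    M.map (homOfLE ((le_shift η ε).trans (le_shift η (shift η ε))))
  ψ_φ : ∀ ε, ψ ε ≫ φ (shift η ε) =
    N.map (homOfLE ((le_shift η ε).trans (le_shift η (shift η ε))))
  map_φ : ∀ {ε ε'} (h : ε ≤ ε'),
    M.map (homOfLE h) ≫ φ ε' = φ ε ≫ N.map (homOfLE (shift_mono η h))
  map_ψ : ∀ {ε ε'} (h : ε ≤ ε'),
    N.map (homOfLE h) ≫ ψ ε' = ψ ε ≫ M.map (homOfLE (shift_mono η h))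

variable {η : ℝ≥0} {M N : Tower r (ModuleCat.{u₃} 𝕜)}

/-- The rank of `M s → N (t + η)`. -/
noncomputable def ModuleInterleaving.imageRank (I : ModuleInterleaving η M N) (s t : ℝ) : ℕ :=
  open scoped Classical in
  if h : r ≤ s ∧ s ≤ t then
    Module.finrank 𝕜 (LinearMap.range ((I.φ ⟨t, h.1.trans h.2⟩).hom ∘ₗ
      (M.map (homOfLE (show (⟨s, h.1⟩ : Set.Ici r) ≤ ⟨t, h.1.trans h.2⟩ from h.2))).hom))
  else 0

lemma ModuleInterleaving.imageRank_coe (I : ModuleInterleaving η M N) {ε ε' : Set.Ici r}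
    (h : ε ≤ ε') : I.imageRank ε ε' = Module.finrank 𝕜
      (LinearMap.range ((I.φ ε').hom ∘ₗ (M.map (homOfLE h)).hom)) :=
  dif_pos ⟨ε.2, h⟩

/-- Naturality gives a second factorisation, through the maps of `N`. The first form controls
changes of birth, this one changes of death. -/
lemma ModuleInterleaving.imageRank_coe' (I : ModuleInterleaving η M N) {ε ε' : Set.Ici r}
    (h : ε ≤ ε') : I.imageRank ε ε' = Module.finrank 𝕜
      (LinearMap.range ((N.map (homOfLE (shift_mono η h))).hom ∘ₗ (I.φ ε).hom)) := by
  rw [I.imageRank_coe h, ← ModuleCat.hom_comp, I.map_φ h, ModuleCat.hom_comp]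

lemma ModuleInterleaving.imageRank_of_lt (I : ModuleInterleaving η M N) {s t : ℝ} (h : s < r) :
    I.imageRank s t = 0 :=
  dif_neg fun h' => h'.1.not_gt h

lemma isRankFunction_persistentRankE (hM : ∀ ε, Module.Finite 𝕜 (M.obj ε)) :
    IsRankFunction (persistentRankE M) := by
  rw [persistentRankE_eq]
  have anti : ∀ {s t t' : ℝ}, s ≤ t → t ≤ t' → persistentRank M s t' ≤ persistentRank M s t := by
    intro s t t' h h'
    by_cases hs : r ≤ s
    · lift s to Set.Ici r using hs
      lift t to Set.Ici r using s.2.trans h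
      lift t' to Set.Ici r using t.2.trans h'
      rw [persistentRank_coe M h, persistentRank_coe M (h.trans h'), M.map_hom_comp h h']
      exact finrank_range_comp_le _ _
    · rw [persistentRank_of_lt M (not_le.1 hs)]
      exact Nat.zero_le _
  refine isRankFunction_extendTop (r := r) ?_ anti ?_ fun s hs t => persistentRank_of_lt M hs
  · intro s s' t h h'
    by_cases hs : r ≤ s
    · lift s to Set.Ici r using hs
      lift s' to Set.Ici r using s.2.trans h
      lift t to Set.Ici r using s'.2.trans h'
      rw [persistentRank_coe M h', persistentRank_coe M (h.trans h'), M.map_hom_comp h h']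
      exact Submodule.finrank_mono (LinearMap.range_comp_le_range _ _)
    · rw [persistentRank_of_lt M (not_le.1 hs)]
      exact Nat.zero_le _
  · intro s s' t t' h h' h''
    by_cases hs : r ≤ s
    · lift s to Set.Ici r using hs
      lift s' to Set.Ici r using s.2.trans h
      lift t to Set.Ici r using s'.2.trans h'
      lift t' to Set.Ici r using t.2.trans h''
      rw [persistentRank_coe M h', persistentRank_coe M (h.trans h'),
        persistentRank_coe M (h'.trans h''), persistentRank_coe M (h.trans (h'.trans h'')),
        M.map_hom_comp h' h'', M.map_hom_comp (h.trans h') h'']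
      refine finrank_range_comp_add_le _ _ _ ?_
      rw [M.map_hom_comp h h']
      exact LinearMap.range_comp_le_range _ _
    · rw [persistentRank_of_lt M (not_le.1 hs), persistentRank_of_lt M (not_le.1 hs)]
      simpa using anti h' h''

lemma ModuleInterleaving.imageRank_anti (I : ModuleInterleaving η M N)
    (hN : ∀ ε, Module.Finite 𝕜 (N.obj ε)) {s t t' : ℝ} (h : s ≤ t) (h' : t ≤ t') :
    I.imageRank s t' ≤ I.imageRank s t := by
  by_cases hs : r ≤ s
  · lift s to Set.Ici r using hs
    lift t to Set.Ici r using s.2.trans h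
    lift t' to Set.Ici r using t.2.trans h'
    rw [I.imageRank_coe' h, I.imageRank_coe' (h.trans h'),
      N.map_hom_comp (shift_mono η h) (shift_mono η h'), LinearMap.comp_assoc]
    exact finrank_range_comp_le _ _
  · rw [I.imageRank_of_lt (not_le.1 hs)]
    exact Nat.zero_le _

lemma ModuleInterleaving.imageRank_le (I : ModuleInterleaving η M N)
    (hM : ∀ ε, Module.Finite 𝕜 (M.obj ε)) {s t : ℝ} (h : s ≤ t) :
    I.imageRank s t ≤ persistentRank M s t := by
  by_cases hs : r ≤ s
  · lift s to Set.Ici r using hs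
    lift t to Set.Ici r using s.2.trans h
    rw [I.imageRank_coe h, persistentRank_coe M h]
    exact finrank_range_comp_le _ _
  · rw [I.imageRank_of_lt (not_le.1 hs)]
    exact Nat.zero_le _

lemma ModuleInterleaving.isRankFunction_imageRank (I : ModuleInterleaving η M N)
    (hN : ∀ ε, Module.Finite 𝕜 (N.obj ε)) :
    IsRankFunction (extendTop I.imageRank) := by
  refine isRankFunction_extendTop (r := r) ?_ (I.imageRank_anti hN) ?_
    fun s hs t => I.imageRank_of_lt hs
  · intro s s' t h h'
    by_cases hs : r ≤ s
    · lift s to Set.Ici r using hs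
      lift s' to Set.Ici r using s.2.trans h
      lift t to Set.Ici r using s'.2.trans h'
      rw [I.imageRank_coe h', I.imageRank_coe (h.trans h'), M.map_hom_comp h h',
        ← LinearMap.comp_assoc]
      exact Submodule.finrank_mono (LinearMap.range_comp_le_range _ _)
    · rw [I.imageRank_of_lt (not_le.1 hs)]
      exact Nat.zero_le _
  · intro s s' t t' h h' h''
    by_cases hs : r ≤ s
    · lift s to Set.Ici r using hs
      lift s' to Set.Ici r using s.2.trans h
      lift t to Set.Ici r using s'.2.trans h'
      lift t' to Set.Ici r using t.2.trans h''
      rw [I.imageRank_coe' h', I.imageRank_coe' (h.trans h'),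
        I.imageRank_coe' (h'.trans h''), I.imageRank_coe' (h.trans (h'.trans h'')),
        N.map_hom_comp (shift_mono η h') (shift_mono η h''),
        N.map_hom_comp (shift_mono η (h.trans h')) (shift_mono η h''), LinearMap.comp_assoc,
        LinearMap.comp_assoc]
      refine finrank_range_comp_add_le _ _ _ ?_
      rw [← ModuleCat.hom_comp, ← ModuleCat.hom_comp, ← I.map_φ h', ← I.map_φ (h.trans h'),
        ModuleCat.hom_comp,
        ModuleCat.hom_comp, M.map_hom_comp h h', ← LinearMap.comp_assoc]
      exact LinearMap.range_comp_le_range _ _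
    · rw [I.imageRank_of_lt (not_le.1 hs), I.imageRank_of_lt (not_le.1 hs)]
      simpa using I.imageRank_anti hN h' h''

lemma ModuleInterleaving.persistentRank_add (I : ModuleInterleaving η M N) {ε ε' : Set.Ici r}
    (h : ε ≤ ε') : persistentRank M ε (ε' + 2 * η : ℝ) = Module.finrank 𝕜 (LinearMap.range
      ((I.ψ (shift η ε')).hom ∘ₗ (I.φ ε').hom ∘ₗ (M.map (homOfLE h)).hom)) := by
  have e : (ε' + 2 * η : ℝ) = shift η (shift η ε') := by simp only [shift]; ring
  rw [e, persistentRank_coe M (h.trans ((le_shift η _).trans (le_shift η _))),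
    M.map_hom_comp h ((le_shift η _).trans (le_shift η _)), ← I.φ_ψ, ModuleCat.hom_comp, LinearMap.comp_assoc]

/-- The rank inequalities that hold for an interleaving. -/
theorem ModuleInterleaving.rankInterleaving (I : ModuleInterleaving η M N)
    (hM : ∀ ε, Module.Finite 𝕜 (M.obj ε)) (hN : ∀ ε, Module.Finite 𝕜 (N.obj ε)) :
    RankInterleaving η (persistentRankE M) (extendTop I.imageRank) (persistentRankE N) where
  left := isRankFunction_persistentRankE hM
  image := I.isRankFunction_imageRank hN
  right := isRankFunction_persistentRankE hN
  image_left {s s' t} h h' := by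
    simp only [persistentRankE_eq, extendTop_coe]
    by_cases hs : r ≤ s
    · lift s to Set.Ici r using hs
      lift s' to Set.Ici r using s.2.trans h
      lift t to Set.Ici r using s'.2.trans h'
      rw [I.imageRank_coe h', I.imageRank_coe (h.trans h'), persistentRank_coe M h',
        persistentRank_coe M (h.trans h')]
      refine finrank_range_comp_add_le _ _ _ ?_
      rw [M.map_hom_comp h h']
      exact LinearMap.range_comp_le_range _ _
    · rw [I.imageRank_of_lt (not_le.1 hs), persistentRank_of_lt M (not_le.1 hs)]
      exact I.imageRank_le hM h'
  left_image {s s' t} h h' := by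
    simp only [persistentRankE_eq, extendTop_coe]
    by_cases hs : r ≤ s
    · lift s to Set.Ici r using hs
      lift s' to Set.Ici r using s.2.trans h
      lift t to Set.Ici r using s'.2.trans h'
      rw [I.imageRank_coe h', I.imageRank_coe (h.trans h'), I.persistentRank_add h',
        I.persistentRank_add (h.trans h')]
      refine finrank_range_comp_add_le _ _ _ ?_
      rw [M.map_hom_comp h h', ← LinearMap.comp_assoc]
      exact LinearMap.range_comp_le_range _ _
    · rw [I.imageRank_of_lt (not_le.1 hs), persistentRank_of_lt M (not_le.1 hs)]
      by_cases hs' : r ≤ s'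
      · lift s' to Set.Ici r using hs'
        lift t to Set.Ici r using s'.2.trans h'
        rw [I.imageRank_coe h', I.persistentRank_add h']
        exact finrank_range_comp_le _ _
      · rw [persistentRank_of_lt M (not_le.1 hs')]
        exact Nat.zero_le _
  image_right {s t t'} h h' := by
    simp only [persistentRankE_eq, extendTop_coe]
    by_cases hs : r ≤ s
    · lift s to Set.Ici r using hs
      lift t to Set.Ici r using s.2.trans h
      have e : persistentRank N (s + η) (t + η) = Module.finrank 𝕜 (LinearMap.range
        (N.map (homOfLE (shift_mono η h))).hom) := persistentRank_coe N (shift_mono η h)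
      induction t' with
      | bot => simp at h'
      | top =>
        simp only [EReal.top_add_coe, extendTop_top, add_zero]
        rw [I.imageRank_coe' h, e]
        exact Submodule.finrank_mono (LinearMap.range_comp_le_range _ _)
      | coe t' =>
        have h' := EReal.coe_le_coe_iff.1 h'
        lift t' to Set.Ici r using t.2.trans h'
        have e' : persistentRank N (s + η) (t' + η) = Module.finrank 𝕜 (LinearMap.range
          (N.map (homOfLE (shift_mono η (h.trans h')))).hom) :=
            persistentRank_coe N (shift_mono η (h.trans h'))
        rw [← EReal.coe_add, extendTop_coe, extendTop_coe, e, e', I.imageRank_coe' h,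
          I.imageRank_coe' (h.trans h'), N.map_hom_comp (shift_mono η h) (shift_mono η h'),
          LinearMap.comp_assoc, add_comm]
        exact finrank_range_comp_add_le _ _ _ (LinearMap.range_comp_le_range _ _)
    -- Although `M` vanishes at `s`, the scale `s + η` may be at least `r`, so the terms of `N` need
    -- not vanish; monotonicity in the death suffices.
    · have := (isRankFunction_persistentRankE hN).anti (s := s + η) (t := (t + η : ℝ))
        (t' := t' + (η : ℝ)) (EReal.coe_le_coe_iff.2 (by linarith))
        (by rw [EReal.coe_add]; exact add_le_add_left h' _)
      rw [persistentRankE_eq, extendTop_coe] at this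
      rw [I.imageRank_of_lt (not_le.1 hs)]
      omega
  right_image {s t t'} h h' := by
    simp only [persistentRankE_eq, extendTop_coe]
    have hη := η.2
    -- The factorisation starts with `ψ` at `u = s + η`, so the case split is at this scale: the map
    -- from `N u` passes through `M (s + 2η)`.
    by_cases hs : r ≤ s + η
    · obtain ⟨u, hu⟩ : ∃ u : Set.Ici r, (u : ℝ) = s + η := ⟨⟨_, hs⟩, rfl⟩
      have hut : shift η u ≤ t := by simp only [shift, hu]; linarith
      have hu' : s + 2 * η = shift η u := by simp only [shift, hu]; ring
      rw [hu', ← hu]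
      lift t to Set.Ici r using (shift η u).2.trans hut
      have hut' : u ≤ shift η t := (le_shift η u).trans ((show shift η u ≤ t from hut).trans
        (le_shift η t))
      have e : persistentRank N u (t + η) = Module.finrank 𝕜 (LinearMap.range
        (N.map (homOfLE hut')).hom) := persistentRank_coe N hut'
      have c : (N.map (homOfLE hut')).hom =
          ((N.map (homOfLE (shift_mono η hut))).hom ∘ₗ (I.φ (shift η u)).hom) ∘ₗ (I.ψ u).hom := by
        rw [LinearMap.comp_assoc, ← ModuleCat.hom_comp, I.ψ_φ, ← N.map_hom_comp]
      induction t' with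
      | bot => simp at h'
      | top =>
        simp only [EReal.top_add_coe, extendTop_top, add_zero]
        rw [I.imageRank_coe' hut, e, c]
        exact Submodule.finrank_mono (LinearMap.range_comp_le_range _ _)
      | coe t' =>
        have h' := EReal.coe_le_coe_iff.1 h'
        lift t' to Set.Ici r using t.2.trans h'
        have e' : persistentRank N u (t' + η) = Module.finrank 𝕜 (LinearMap.range
          (N.map (homOfLE (hut'.trans (shift_mono η h')))).hom) :=
            persistentRank_coe N (hut'.trans (shift_mono η h'))
        rw [← EReal.coe_add, extendTop_coe, extendTop_coe, e, e', I.imageRank_coe' hut,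
          I.imageRank_coe' (hut.trans h'), N.map_hom_comp (shift_mono η hut) (shift_mono η h'),
          LinearMap.comp_assoc, N.map_hom_comp hut' (shift_mono η h'), add_comm]
        refine finrank_range_comp_add_le _ _ _ ?_
        rw [c]
        exact LinearMap.range_comp_le_range _ _
    · have := (I.isRankFunction_imageRank hN).anti (s := s + 2 * η) (t := t) (t' := t')
        (EReal.coe_le_coe_iff.2 h) h'
      rw [extendTop_coe] at this
      rw [persistentRank_of_lt N (not_le.1 hs)]
      omega

/-- Algebraic stability: diagrams of interleaved towers can be matched. -/
theorem ModuleInterleaving.hasMatching (I : ModuleInterleaving η M N)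
    (hM : ∀ ε, Module.Finite 𝕜 (M.obj ε)) (hN : ∀ ε, Module.Finite 𝕜 (N.obj ε)) :
    PersistenceDiagram.HasMatching (persistenceDiagram M) (persistenceDiagram N) η := by
  rw [persistenceDiagram_eq, persistenceDiagram_eq]
  exact (I.rankInterleaving hM hN).hasMatching

end Towers

/-! ### Contiguous maps and homology -/

section Contiguous

open MonoidalCategory Simplicial Opposite

universe u₁ u₀

variable {K L : FinComplex.{u₁}}

/-- Contiguous simplicial maps are homotopic. -/
noncomputable def SimplicialMap.Contiguous.homotopy {f g : K ⟶ L}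
    (h : SimplicialMap.Contiguous f g) :
    SSet.Homotopy (orderedSimplices.map f) (orderedSimplices.map g) where
  h :=
    -- Vertices over `0` are moved by `f`, the others by `g`, so the result lies in `f(σ) ∪ g(σ)`.
    -- Ordered tuples with repetitions make this work without an order on the vertices.
    { app := fun n => ↾fun p => ⟨fun j =>
        if SSet.stdSimplex.asOrderHom p.2 j = 0 then SimplicialMap.toFun f (p.1.1 j)
          else SimplicialMap.toFun g (p.1.1 j), by
        classical
        refine (L.complex.isRelLowerSet_faces (h _ p.1.2)).2 ?_ (Finset.univ_nonempty.image _)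
        intro v hv
        obtain ⟨j, -, rfl⟩ := Finset.mem_image.1 hv
        simp only [Finset.mem_union, Finset.mem_image, Finset.mem_univ, true_and]
        split_ifs
        · exact Or.inl ⟨_, ⟨j, rfl⟩, rfl⟩
        · exact Or.inr ⟨_, ⟨j, rfl⟩, rfl⟩⟩
      naturality := fun _ _ _ => rfl }
  h₀ := rfl
  h₁ := rfl
  rel := by
    ext n ⟨⟨x, hx⟩, y⟩
    exact hx.elim

lemma SimplicialMap.Contiguous.simplicialHomology_map_eq (𝕜 : Type u₀) [Field 𝕜] (k : ℕ)
    {f g : K ⟶ L} (h : SimplicialMap.Contiguous f g) :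
    (simplicialHomology 𝕜 k).map f = (simplicialHomology 𝕜 k).map g :=
  h.homotopy.congr_homologyMap _ k

end Contiguous

/-! ### Finiteness -/

section Finiteness

universe u₁ u₀

lemma finite_homology {𝕜 : Type u₀} [Field 𝕜] (S : ShortComplex (ModuleCat.{u₁} 𝕜))
    [Module.Finite 𝕜 S.X₂] : Module.Finite 𝕜 S.homology := by
  have := Module.Finite.of_injective S.iCycles.hom ((ModuleCat.mono_iff_injective _).1 inferInstance)
  exact Module.Finite.of_surjective S.homologyπ.hom
    ((ModuleCat.epi_iff_surjective _).1 inferInstance)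

instance finite_orderedSimplices (K : FinComplex.{u₁}) (n) :
    Finite ((orderedSimplices.obj K).obj n) :=
  have := K.finite
  inferInstanceAs (Finite {_s : Fin (n.unop.len + 1) → K.V // _})

/-- There are finitely many ordered simplices in each degree, so the chains are a finite direct sum
of copies of the field. -/
lemma finite_simplicialHomology (𝕜 : Type u₀) [Field 𝕜] (k : ℕ) (K : FinComplex.{u₁}) :
    Module.Finite 𝕜 ((simplicialHomology 𝕜 k).obj K) := by
  classical
  set X := orderedSimplices.obj K
  have : Module.Finite 𝕜
      ((X.chainComplex (ModuleCat.of 𝕜 (ULift.{u₁} 𝕜))).sc k).X₂ := by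
    have : Module.Finite 𝕜 (Π₀ _ : X.obj (.op (.mk k)), ULift.{u₁} 𝕜) :=
      inferInstance
    exact Module.Finite.equiv (ModuleCat.coprodIsoDirectSum
      (fun _ : X.obj (.op (.mk k)) => ModuleCat.of 𝕜 (ULift.{u₁} 𝕜))).symm.toLinearEquiv
  exact finite_homology _

end Finiteness

/-! ### Change of universe -/

section Universe

open Limits Simplicial Opposite

universe u₂ u₁ u₀

variable (𝕜 : Type u₀) [Field 𝕜]

/-- The coefficients in a larger universe. -/
def uliftCoeff : ModuleCat.of 𝕜 (ULift.{max u₁ u₂} 𝕜) ≅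
    (ModuleCat.uliftFunctor.{u₂, max u₁ u₀} 𝕜).obj (ModuleCat.of 𝕜 (ULift.{u₁} 𝕜)) :=
  (ULift.moduleEquiv.trans (ULift.moduleEquiv.symm.trans ULift.moduleEquiv.symm)).toModuleIso

variable (X : SSet.{u₁})

/-- The comparison of the chains of a simplicial set in two universes. -/
noncomputable def chainULift (n : ℕ) :
    ((SSet.uliftFunctor.{u₂, u₁}.obj X).chainComplex (ModuleCat.of 𝕜 (ULift.{max u₁ u₂} 𝕜))).X n ⟶
      (ModuleCat.uliftFunctor.{u₂, max u₁ u₀} 𝕜).obj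
        ((X.chainComplex (ModuleCat.of 𝕜 (ULift.{u₁} 𝕜))).X n) :=
  Cofan.IsColimit.desc (SSet.isColimitChainComplexXCofan _ _ n) fun x =>
    (uliftCoeff.{u₂, u₁} 𝕜).hom ≫ (ModuleCat.uliftFunctor.{u₂, max u₁ u₀} 𝕜).map
      (X.ιChainComplex x.down)

lemma ι_chainULift {n : ℕ} (x : (SSet.uliftFunctor.{u₂, u₁}.obj X) _⦋n⦌) :
    (SSet.uliftFunctor.{u₂, u₁}.obj X).ιChainComplex x ≫ chainULift.{u₂, u₁} 𝕜 X n =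
      (uliftCoeff.{u₂, u₁} 𝕜).hom ≫ (ModuleCat.uliftFunctor.{u₂, max u₁ u₀} 𝕜).map
        (X.ιChainComplex x.down) :=
  Cofan.IsColimit.fac (SSet.isColimitChainComplexXCofan _ _ n) _ x

lemma ι_chainULift_assoc {n : ℕ} (x : (SSet.uliftFunctor.{u₂, u₁}.obj X) _⦋n⦌)
    {A : ModuleCat.{max u₁ u₂ u₀} 𝕜} (h : (ModuleCat.uliftFunctor.{u₂, max u₁ u₀} 𝕜).obj
      ((X.chainComplex (ModuleCat.of 𝕜 (ULift.{u₁} 𝕜))).X n) ⟶ A) :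
    (SSet.uliftFunctor.{u₂, u₁}.obj X).ιChainComplex x ≫ chainULift.{u₂, u₁} 𝕜 X n ≫ h =
      (uliftCoeff.{u₂, u₁} 𝕜).hom ≫ (ModuleCat.uliftFunctor.{u₂, max u₁ u₀} 𝕜).map
        (X.ιChainComplex x.down) ≫ h := by
  rw [← Category.assoc, ι_chainULift, Category.assoc]

/-- Chains are a coproduct over the simplices. With finitely many of them, the additive functor that
lifts modules preserves this coproduct. -/
lemma isIso_chainULift (n : ℕ) [Finite (X _⦋n⦌)] : IsIso (chainULift.{u₂, u₁} 𝕜 X n) := by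
  let t := isColimitCofanMkObjOfIsColimit (ModuleCat.uliftFunctor.{u₂, max u₁ u₀} 𝕜) _
    (X.ιChainComplex (R := ModuleCat.of 𝕜 (ULift.{u₁} 𝕜)))
    (X.isColimitChainComplexXCofan (ModuleCat.of 𝕜 (ULift.{u₁} 𝕜)) n)
  have fac := Cofan.IsColimit.fac t fun x => (uliftCoeff.{u₂, u₁} 𝕜).inv ≫
    (SSet.uliftFunctor.{u₂, u₁}.obj X).ιChainComplex (n := n) (ULift.up x)
  refine ⟨Cofan.IsColimit.desc t fun x => (uliftCoeff.{u₂, u₁} 𝕜).inv ≫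
    (SSet.uliftFunctor.{u₂, u₁}.obj X).ιChainComplex (ULift.up x), ?_, ?_⟩
  · refine SSet.chainComplex_hom_ext fun x => ?_
    rw [ι_chainULift_assoc, Category.comp_id]
    erw [fac]
    rw [Iso.hom_inv_id_assoc]
    rfl
  · refine Cofan.IsColimit.hom_ext t _ _ fun x => ?_
    exact ((Category.assoc _ _ _).symm.trans (congrArg (· ≫ chainULift.{u₂, u₁} 𝕜 X n)
      (fac x))).trans ((Category.assoc _ _ _).trans ((congrArg ((uliftCoeff.{u₂, u₁} 𝕜).inv ≫ ·)
        (ι_chainULift 𝕜 X (ULift.up x))).trans ((Iso.inv_hom_id_assoc _ _).trans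
          (Category.comp_id _).symm)))

lemma chainULift_comm (n : ℕ) :
    chainULift.{u₂, u₁} 𝕜 X (n + 1) ≫ (ModuleCat.uliftFunctor.{u₂, max u₁ u₀} 𝕜).map
        ((X.chainComplex (ModuleCat.of 𝕜 (ULift.{u₁} 𝕜))).d (n + 1) n) =
      ((SSet.uliftFunctor.{u₂, u₁}.obj X).chainComplex _).d (n + 1) n ≫
        chainULift.{u₂, u₁} 𝕜 X n := by
  refine SSet.chainComplex_hom_ext fun x => ?_
  rw [ι_chainULift_assoc, SSet.ιChainComplex_d_assoc, ← Functor.map_comp, SSet.ιChainComplex_d,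
    Functor.map_sum, Preadditive.comp_sum, Preadditive.sum_comp]
  refine Finset.sum_congr rfl fun i _ => ?_
  rw [Preadditive.zsmul_comp, ι_chainULift, Functor.map_zsmul, Preadditive.comp_zsmul]
  rfl

/-- The comparison of chain complexes in two universes. -/
noncomputable def chainComplexULift :
    (SSet.uliftFunctor.{u₂, u₁}.obj X).chainComplex (ModuleCat.of 𝕜 (ULift.{max u₁ u₂} 𝕜)) ⟶
      ((ModuleCat.uliftFunctor.{u₂, max u₁ u₀} 𝕜).mapHomologicalComplex _).obj
        (X.chainComplex (ModuleCat.of 𝕜 (ULift.{u₁} 𝕜))) where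
  f := chainULift.{u₂, u₁} 𝕜 X
  comm' i j hij := by
    obtain rfl : j + 1 = i := hij
    exact chainULift_comm 𝕜 X j

variable {X} {Y : SSet.{u₁}}

lemma chainULift_naturality (f : X ⟶ Y) (n : ℕ) :
    (SSet.chainComplexMap (SSet.uliftFunctor.{u₂, u₁}.map f) _).f n ≫ chainULift.{u₂, u₁} 𝕜 Y n =
      chainULift.{u₂, u₁} 𝕜 X n ≫ (ModuleCat.uliftFunctor.{u₂, max u₁ u₀} 𝕜).map
        ((SSet.chainComplexMap f (ModuleCat.of 𝕜 (ULift.{u₁} 𝕜))).f n) := by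
  refine SSet.chainComplex_hom_ext fun x => ?_
  rw [SSet.ι_chainComplexMap_f_assoc, ι_chainULift, ι_chainULift_assoc, ← Functor.map_comp,
    SSet.ι_chainComplexMap_f]
  rfl

lemma chainComplexULift_naturality (f : X ⟶ Y) :
    SSet.chainComplexMap (SSet.uliftFunctor.{u₂, u₁}.map f) _ ≫ chainComplexULift.{u₂, u₁} 𝕜 Y =
      chainComplexULift.{u₂, u₁} 𝕜 X ≫
        ((ModuleCat.uliftFunctor.{u₂, max u₁ u₀} 𝕜).mapHomologicalComplex _).map
          (SSet.chainComplexMap f _) := by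
  ext n : 1
  exact chainULift_naturality 𝕜 f n

instance isIso_chainComplexULift [∀ n, Finite (X.obj n)] :
    IsIso (chainComplexULift.{u₂, u₁} 𝕜 X) := by
  have := fun n => isIso_chainULift.{u₂, u₁} 𝕜 X n
  have : ∀ n, IsIso ((chainComplexULift.{u₂, u₁} 𝕜 X).f n) := this
  exact HomologicalComplex.Hom.isIso_of_components _

lemma finrank_range_eq_of_equiv {𝕜 A B A' B' : Type*} [Field 𝕜] [AddCommGroup A] [Module 𝕜 A]
    [AddCommGroup B] [Module 𝕜 B] [AddCommGroup A'] [Module 𝕜 A'] [AddCommGroup B'] [Module 𝕜 B']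
    (i : A ≃ₗ[𝕜] A') (j : B ≃ₗ[𝕜] B') {f : A →ₗ[𝕜] B} {g : A' →ₗ[𝕜] B'}
    (h : j.toLinearMap ∘ₗ f = g ∘ₗ i.toLinearMap) :
    Module.finrank 𝕜 (LinearMap.range f) = Module.finrank 𝕜 (LinearMap.range g) := by
  have h1 := congrArg LinearMap.range h
  rw [LinearMap.range_comp, LinearMap.range_comp_of_range_eq_top _ i.range] at h1
  rw [← h1]
  exact (LinearEquiv.finrank_map_eq j _).symm

lemma finrank_range_eq_of_iso {A B A' B' : ModuleCat.{u₁} 𝕜} (i : A ≅ A') (j : B ≅ B')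
    {f : A ⟶ B} {g : A' ⟶ B'} (h : f ≫ j.hom = i.hom ≫ g) :
    Module.finrank 𝕜 (LinearMap.range f.hom) = Module.finrank 𝕜 (LinearMap.range g.hom) :=
  finrank_range_eq_of_equiv i.toLinearEquiv j.toLinearEquiv
    (congrArg ModuleCat.Hom.hom h)

lemma finrank_range_uliftFunctor_map {A B : ModuleCat.{u₁} 𝕜} (f : A ⟶ B) :
    Module.finrank 𝕜 (LinearMap.range ((ModuleCat.uliftFunctor.{u₂} 𝕜).map f).hom) =
      Module.finrank 𝕜 (LinearMap.range f.hom) :=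
  finrank_range_eq_of_equiv (ULift.moduleEquiv (M := A)) (ULift.moduleEquiv (M := B)) rfl

/-- Two natural isomorphisms combine: the comparison of chains, and the commutation of lifting
modules with homology. -/
lemma finrank_range_homologyMap_uliftFunctor [∀ n, Finite (X.obj n)] [∀ n, Finite (Y.obj n)]
    (f : X ⟶ Y) (k : ℕ) :
    Module.finrank 𝕜 (LinearMap.range (SSet.homologyMap (SSet.uliftFunctor.{u₂, u₁}.map f)
      (ModuleCat.of 𝕜 (ULift.{max u₁ u₂} 𝕜)) k).hom) =
    Module.finrank 𝕜 (LinearMap.range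
      (SSet.homologyMap f (ModuleCat.of 𝕜 (ULift.{u₁} 𝕜)) k).hom) := by
  have h := congrArg (fun g => HomologicalComplex.homologyMap g k)
    (chainComplexULift_naturality.{u₂, u₁} 𝕜 f)
  simp only [HomologicalComplex.homologyMap_comp] at h
  have h' := ShortComplex.mapHomologyIso_hom_naturality
    ((HomologicalComplex.shortComplexFunctor _ _ k).map
      (SSet.chainComplexMap f (ModuleCat.of 𝕜 (ULift.{u₁} 𝕜))))
    (ModuleCat.uliftFunctor.{u₂, max u₁ u₀} 𝕜)
  refine (finrank_range_eq_of_iso 𝕜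
    (asIso (HomologicalComplex.homologyMap (chainComplexULift.{u₂, u₁} 𝕜 X) k))
    (asIso (HomologicalComplex.homologyMap (chainComplexULift.{u₂, u₁} 𝕜 Y) k)) h).trans ?_
  refine Eq.trans ?_ (finrank_range_uliftFunctor_map.{u₂} 𝕜 _)
  exact finrank_range_eq_of_iso 𝕜 _ _ h'

/-! ### Simplicial complexes in a larger universe -/

/-- A finite simplicial complex in a larger universe. -/
def FinComplex.ulift (K : FinComplex.{u₁}) : FinComplex.{max u₁ u₂} where
  V := ULift.{u₂} K.V
  finite := have := K.finite; inferInstance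
  complex :=
    { faces := {σ | σ.map Equiv.ulift.toEmbedding ∈ K.complex.faces}
      isRelLowerSet_faces := fun _ hσ =>
        ⟨Finset.map_nonempty.1 (K.complex.isRelLowerSet_faces hσ).1, fun _ hτ hne =>
          (K.complex.isRelLowerSet_faces hσ).2 (Finset.map_subset_map.2 hτ) (hne.map)⟩ }

/-- The vertex of `K` underlying a vertex of `K.ulift`. -/
def FinComplex.down {K : FinComplex.{u₁}} (v : (FinComplex.ulift.{u₂} K).V) : K.V :=
  ULift.down v

/-- The vertex of `K.ulift` given by a vertex of `K`. -/
def FinComplex.up {K : FinComplex.{u₁}} (v : K.V) : (FinComplex.ulift.{u₂} K).V :=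
  ULift.up v

open scoped Classical in
lemma FinComplex.mem_ulift {K : FinComplex.{u₁}} {σ : Finset (FinComplex.ulift.{u₂} K).V} :
    σ ∈ (FinComplex.ulift.{u₂} K).complex.faces ↔ σ.image FinComplex.down ∈ K.complex.faces :=
  iff_of_eq (congrArg (· ∈ K.complex.faces) (Finset.map_eq_image _ _))

open scoped Classical in
lemma FinComplex.image_mem_ulift {K : FinComplex.{u₁}} {ι : Type*} {σ : Finset ι}
    {f : ι → (FinComplex.ulift.{u₂} K).V} :
    σ.image f ∈ (FinComplex.ulift.{u₂} K).complex.faces ↔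
      σ.image (fun i => FinComplex.down (f i)) ∈ K.complex.faces := by
  rw [FinComplex.mem_ulift, Finset.image_image]
  rfl

universe u₃ u₄

/-- A simplicial map in a larger universe. -/
def SimplicialMap.ulift {K : FinComplex.{u₁}} {L : FinComplex.{u₂}} (f : SimplicialMap K L) :
    SimplicialMap (FinComplex.ulift.{u₃} K) (FinComplex.ulift.{u₄} L) where
  toFun v := FinComplex.up (f.toFun (FinComplex.down v))
  image_mem σ hσ := by
    classical
    have h := f.image_mem _ (FinComplex.mem_ulift.1 hσ)
    rw [Finset.image_image] at h
    rw [FinComplex.mem_ulift, Finset.image_image]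
    exact h

lemma SimplicialMap.Contiguous.ulift {K : FinComplex.{u₁}} {L : FinComplex.{u₂}}
    {f g : SimplicialMap K L} (h : f.Contiguous g) :
    (SimplicialMap.ulift.{u₂, u₁, u₃, u₄} f).Contiguous (SimplicialMap.ulift.{u₂, u₁, u₃, u₄} g) := by
  classical
  intro σ hσ
  have h := h _ (FinComplex.mem_ulift.1 hσ)
  rw [Finset.image_image, Finset.image_image] at h
  rw [FinComplex.mem_ulift, Finset.image_union, Finset.image_image, Finset.image_image]
  exact h

/-- The functor to finite simplicial complexes in a larger universe. -/
def FinComplex.uliftFunctor : FinComplex.{u₁} ⥤ FinComplex.{max u₁ u₂} where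
  obj K := FinComplex.ulift.{u₂} K
  map f := SimplicialMap.ulift.{u₁, u₁, u₂, u₂} f

/-- The ordered simplices of a complex in a larger universe. -/
def orderedSimplicesULift (K : FinComplex.{u₁}) :
    orderedSimplices.obj (FinComplex.uliftFunctor.{u₂}.obj K) ≅
      SSet.uliftFunctor.{u₂, u₁}.obj (orderedSimplices.obj K) where
  hom :=
    { app := fun n => ↾fun s => ULift.up ⟨fun i => FinComplex.down (s.1 i),
        FinComplex.image_mem_ulift.1 s.2⟩ }
  inv :=
    { app := fun n => ↾fun s => ⟨fun i => FinComplex.up (ULift.down s |>.1 i),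
        FinComplex.image_mem_ulift.2 (ULift.down s).2⟩ }

lemma finrank_range_simplicialHomology_ulift {K L : FinComplex.{u₁}} (f : K ⟶ L) (k : ℕ) :
    Module.finrank 𝕜 (LinearMap.range
      ((simplicialHomology 𝕜 k).map (FinComplex.uliftFunctor.{u₂}.map f)).hom) =
    Module.finrank 𝕜 (LinearMap.range ((simplicialHomology 𝕜 k).map f).hom) := by
  refine Eq.trans ?_ (finrank_range_homologyMap_uliftFunctor.{u₂} 𝕜 (orderedSimplices.map f) k)
  have h : orderedSimplices.map (FinComplex.uliftFunctor.{u₂}.map f) ≫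
      (orderedSimplicesULift.{u₂} L).hom = (orderedSimplicesULift.{u₂} K).hom ≫
        SSet.uliftFunctor.{u₂, u₁}.map (orderedSimplices.map f) := rfl
  have h' := congrArg (SSet.homologyFunctor (ModuleCat.of 𝕜 (ULift.{max u₁ u₂} 𝕜)) k).map h
  rw [Functor.map_comp, Functor.map_comp] at h'
  exact finrank_range_eq_of_iso 𝕜
    ((SSet.homologyFunctor (ModuleCat.of 𝕜 (ULift.{max u₁ u₂} 𝕜)) k).mapIso
      (orderedSimplicesULift.{u₂} K))
    ((SSet.homologyFunctor (ModuleCat.of 𝕜 (ULift.{max u₁ u₂} 𝕜)) k).mapIso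
      (orderedSimplicesULift.{u₂} L)) h'

/-- The diagram depends only on the ranks of the structure maps, and these are unchanged. -/
lemma simplicialPersistenceDiagram_ulift (k : ℕ) {r : ℝ} (S : Tower r FinComplex.{u₁}) :
    simplicialPersistenceDiagram 𝕜 k (S ⋙ FinComplex.uliftFunctor.{u₂}) =
      simplicialPersistenceDiagram 𝕜 k S := by
  have h : persistentRank ((S ⋙ FinComplex.uliftFunctor.{u₂}) ⋙ simplicialHomology 𝕜 k) =
      persistentRank (S ⋙ simplicialHomology 𝕜 k) := by
    funext s t
    unfold persistentRank
    split_ifs with h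
    · exact finrank_range_simplicialHomology_ulift 𝕜 _ k
    · rfl
  unfold simplicialPersistenceDiagram
  rw [persistenceDiagram_eq, persistenceDiagram_eq, persistentRankE_eq, persistentRankE_eq, h]

end Universe

/-! ### Stability for towers of simplicial complexes -/

section Stability

universe u₁ u₂ u₀

variable (𝕜 : Type u₀) [Field 𝕜]

/-- The interleaving of homology given by an interleaving of towers of simplicial complexes. -/
lemma SimplicialInterleaved.nonempty_moduleInterleaving {r : ℝ} {η : ℝ≥0}
    {S : Tower r FinComplex.{u₁}} {T : Tower r FinComplex.{u₂}}
    (h : SimplicialInterleaved η S T) (k : ℕ) :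
    Nonempty (ModuleInterleaving η
      ((S ⋙ FinComplex.uliftFunctor.{u₂}) ⋙ simplicialHomology.{max u₁ u₂} 𝕜 k)
      ((T ⋙ FinComplex.uliftFunctor.{u₁}) ⋙ simplicialHomology.{max u₁ u₂} 𝕜 k)) := by
  obtain ⟨φ, ψ, h1, h2, h3, h4⟩ := h
  let φ' (ε) : (S ⋙ FinComplex.uliftFunctor.{u₂}).obj ε ⟶
    (T ⋙ FinComplex.uliftFunctor.{u₁}).obj (shift η ε) := SimplicialMap.ulift.{u₂, u₁, u₂, u₁} (φ ε)
  let ψ' (ε) : (T ⋙ FinComplex.uliftFunctor.{u₁}).obj ε ⟶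
    (S ⋙ FinComplex.uliftFunctor.{u₂}).obj (shift η ε) := SimplicialMap.ulift.{u₁, u₂, u₁, u₂} (ψ ε)
  refine ⟨⟨fun ε => (simplicialHomology 𝕜 k).map (φ' ε),
    fun ε => (simplicialHomology 𝕜 k).map (ψ' ε), fun ε => ?_, fun ε => ?_, fun {ε ε'} h => ?_,
    fun {ε ε'} h => ?_⟩⟩
  · rw [← Functor.map_comp]
    exact (h1 ε).ulift.simplicialHomology_map_eq 𝕜 k
  · rw [← Functor.map_comp]
    exact (h2 ε).ulift.simplicialHomology_map_eq 𝕜 k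
  · exact ((simplicialHomology 𝕜 k).map_comp ((S ⋙ FinComplex.uliftFunctor.{u₂}).map (homOfLE h))
      (φ' ε')).symm.trans (((h3 ε ε' h).ulift.simplicialHomology_map_eq 𝕜 k).trans
        ((simplicialHomology 𝕜 k).map_comp (φ' ε) ((T ⋙ FinComplex.uliftFunctor.{u₁}).map
          (homOfLE (shift_mono η h)))))
  · exact ((simplicialHomology 𝕜 k).map_comp ((T ⋙ FinComplex.uliftFunctor.{u₁}).map (homOfLE h))
      (ψ' ε')).symm.trans (((h4 ε ε' h).ulift.simplicialHomology_map_eq 𝕜 k).symm.trans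
        ((simplicialHomology 𝕜 k).map_comp (ψ' ε) ((S ⋙ FinComplex.uliftFunctor.{u₂}).map
          (homOfLE (shift_mono η h)))))

theorem SimplicialInterleaved.bottleneckDist_le {r : ℝ} {η : ℝ≥0}
    {S : Tower r FinComplex.{u₁}} {T : Tower r FinComplex.{u₂}}
    (h : SimplicialInterleaved η S T) (k : ℕ) :
    PersistenceDiagram.bottleneckDist (simplicialPersistenceDiagram 𝕜 k S)
      (simplicialPersistenceDiagram 𝕜 k T) ≤ (η : ℝ≥0∞) := by
  obtain ⟨I⟩ := h.nonempty_moduleInterleaving 𝕜 k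
  have H := I.hasMatching (fun _ => finite_simplicialHomology 𝕜 k _)
    (fun _ => finite_simplicialHomology 𝕜 k _)
  rw [← simplicialPersistenceDiagram_ulift.{u₂} 𝕜 k S,
    ← simplicialPersistenceDiagram_ulift.{u₁} 𝕜 k T]
  exact iInf₂_le η H

end Stability

/-! ### Interleavings of multiscale mappers -/

section Mapper

universe u₁ u₂ u₅ u₆

/-- The simplicial map of nerves induced by a map of covers. -/
def CoverMap.nerveMap {X : Type u₆} {U : Cover.{u₁, u₆} X} {V : Cover.{u₂, u₆} X}
    (φ : CoverMap U V) : SimplicialMap U.nerve V.nerve where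
  toFun := φ.toFun
  image_mem := by
    classical
    rintro σ ⟨hσ, x, hx⟩
    refine ⟨hσ.image _, x, ?_⟩
    simp only [Set.mem_iInter] at hx ⊢
    intro j hj
    obtain ⟨i, hi, rfl⟩ := Finset.mem_image.1 hj
    exact φ.subset i (hx i hi)

/-- Any two maps of covers with the same source and target induce contiguous maps of nerves. -/
lemma CoverMap.contiguous {X : Type u₆} {U : Cover.{u₁, u₆} X} {V : Cover.{u₂, u₆} X}
    (φ ψ : CoverMap U V) : φ.nerveMap.Contiguous ψ.nerveMap := by
  classical
  rintro σ ⟨hσ, x, hx⟩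
  refine ⟨(hσ.image _).mono Finset.subset_union_left, x, ?_⟩
  simp only [Set.mem_iInter] at hx ⊢
  intro j hj
  rcases Finset.mem_union.1 hj with hj | hj
  · obtain ⟨i, hi, rfl⟩ := Finset.mem_image.1 hj
    exact φ.subset i (hx i hi)
  · obtain ⟨i, hi, rfl⟩ := Finset.mem_image.1 hj
    exact ψ.subset i (hx i hi)

variable {X : Type u₆} {Z : Type u₅} [TopologicalSpace X] [TopologicalSpace Z]

/-- The map of pullback covers induced by a map of covers. -/
def CoverMap.pullback (f : C(X, Z)) (hf : WellBehaved f) {U : OpenCover.{u₁, u₅} Z}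
    {V : OpenCover.{u₂, u₅} Z} (φ : CoverMap U.toCover V.toCover) :
    CoverMap (U.pullback f hf) (V.pullback f hf) where
  toFun p := ⟨φ.toFun p.1, pathComponentMap (Set.preimage_mono (φ.subset p.1)) p.2⟩
  subset := by
    rintro ⟨i, c⟩ _ ⟨x, hx, rfl⟩
    exact ⟨Set.inclusion (Set.preimage_mono (φ.subset i)) x,
      congrArg (pathComponentMap (Set.preimage_mono (φ.subset i))) hx, rfl⟩

theorem CoverInterleaved.multiscaleMapper {r : ℝ} {η : ℝ≥0} {U : Tower r (OpenCover.{u₁, u₅} Z)}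
    {V : Tower r (OpenCover.{u₂, u₅} Z)} (h : CoverInterleaved η U V) (f : C(X, Z))
    (hf : WellBehaved f) :
    SimplicialInterleaved η (multiscaleMapper U f hf) (multiscaleMapper V f hf) := by
  -- No compatibility between different scales is imposed on these choices; contiguity of parallel
  -- maps of covers supplies it.
  have φ := fun ε => (h.1 ε).some
  have ψ := fun ε => (h.2 ε).some
  let u {ε ε'} (h : ε ≤ ε') : CoverMap ((U.obj ε).pullback f hf) ((U.obj ε').pullback f hf) :=
    (pullbackFunctor f hf).map (U.map (homOfLE h))
  let v {ε ε'} (h : ε ≤ ε') : CoverMap ((V.obj ε).pullback f hf) ((V.obj ε').pullback f hf) :=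
    (pullbackFunctor f hf).map (V.map (homOfLE h))
  refine ⟨fun ε => ((φ ε).pullback f hf).nerveMap, fun ε => ((ψ ε).pullback f hf).nerveMap,
    fun ε => ?_, fun ε => ?_, fun ε ε' h => ?_, fun ε ε' h => ?_⟩
  · exact CoverMap.contiguous (((φ ε).pullback f hf).comp ((ψ (shift η ε)).pullback f hf)) (u _)
  · exact CoverMap.contiguous (((ψ ε).pullback f hf).comp ((φ (shift η ε)).pullback f hf)) (v _)
  · exact CoverMap.contiguous ((u h).comp ((φ ε').pullback f hf))
      (((φ ε).pullback f hf).comp (v (shift_mono η h)))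
  · exact CoverMap.contiguous (((ψ ε).pullback f hf).comp (u (shift_mono η h)))
      ((v h).comp ((ψ ε').pullback f hf))

end Mapper

theorem mainTheorem6 {X : Type u} {Z : Type v}
    [TopologicalSpace X] [TopologicalSpace Z] (𝕜 : Type t) [Field 𝕜]
    (η : ℝ≥0) (r : ℝ) (hr : 0 < r)
    (U : Tower r (OpenCover.{w, v} Z)) (V : Tower r (OpenCover.{w', v} Z))
    (f : C(X, Z)) (hf : WellBehaved f) (hUV : CoverInterleaved η U V) :
    SimplicialInterleaved η (multiscaleMapper U f hf) (multiscaleMapper V f hf) ∧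
    ∀ k : ℕ, PersistenceDiagram.bottleneckDist
      (simplicialPersistenceDiagram 𝕜 k (multiscaleMapper U f hf))
      (simplicialPersistenceDiagram 𝕜 k (multiscaleMapper V f hf)) ≤ (η : ℝ≥0∞) := by
  exact ⟨hUV.multiscaleMapper f hf, fun k => (hUV.multiscaleMapper f hf).bottleneckDist_le 𝕜 k⟩
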